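/- Let $N\ge 2$, let $d=n+1$ with $n\ge 2$ (the case of main interest is $d=4$; also $d=3$), and let $\beta>0$. Consider the sites $x=(x^0,\vec x)\in(\mathbb Z+\tfrac12)\times\mathbb Z^{n}$, with unit vectors $e^\mu$, $\mu=0,\dots,n$, and bond variables $U_b\in SU(N)$ for the bonds $b=[x,x+e^\mu]$. For a plaquette $p=p_{\mu\nu}(x)$, $\mu<\nu$, put $U_p=U_{b_1}U_{b_2}U_{b_3}^\dagger U_{b_4}^\dagger$ with $b_1=[x,x+e^\mu]$, $b_2=[x+e^\mu,x+e^\mu+e^\nu]$, $b_3=[x+e^\nu,x+e^\nu+e^\mu]$, $b_4=[x,x+e^\nu]$. Let $t(x^0,\vec x)=(-x^0,\vec x)$. For a finite set $\Lambda$ of sites with $t\Lambda=\Lambda$ let $$\langle F\rangle_\Lambda=\frac1{Z_\Lambda}\int F(U)\,e^{-\beta A_\Lambda(U)}\prod_b dU_b,\qquad A_\Lambda(U)=\sum_{p\subset\Lambda}2\,\mathrm{Re}\,\mathrm{Tr}(1-U_p),$$ with normalized Haar measures and $Z_\Lambda$ such that $\langle 1\rangle_\Lambda=1$. A thermodynamic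 limit is a probability measure $m$ on $\{U_b\}$ whose expectation $\langle\cdot\rangle$ is the limit of $\langle\cdot\rangle_\Lambda$ on continuous functions along some net of such volumes $\Lambda$ that eventually contain every finite set of sites (if the full limit $\Lambda\nearrow(\mathbb Z+\frac12)\times\mathbb Z^n$ exists, this is the only one). Let $\mathcal A$ be the algebra of functions that are polynomials in the matrix elements of $U_b$ and $U_b^{-1}$, for bonds $b$ in the hyperplane $x^0=\frac12$, and that are invariant under all gauge transformations $U_{[x,y]}\mapsto h(x)U_{[x,y]}h(y)^{-1}$. Let $(\Theta F)(\{g_{uv}\})=\overline{F(\{g_{(tu)(tv)}\})}$, where $g_{vu}=g_{uv}^{-1}$. Then at least one thermodynamic limit exists, and for every thermodynamic limit the following holds. 1. $\langle F\,\Theta F\rangle\ge0$ for all $F\in\mathcal A$. Hence $(G,F)_{\mathcal H}=\langle F\,\Theta G\rangle$ defines, after division by the null vectors and completion, a Hilbert space $\mathcal H$ (the Osterwalder–Schrader–Seiler physical Hilbert space). Below, $F\in\mathcal A$ also denotes its vector in $\mathcal H$. 2. There is a unique bounded linear operator $\mathcal C$ on $\mathcal H$ with $(\mathcal CF)(\{U_b\})=F(\{U_b^*\})$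 for all $F\in\mathcal A$, where $U^*$ is the entrywise complex conjugate. It is unitary and self-adjoint, and $\mathcal C^2=1$. 3. $P_\pm=(1\pm\mathcal C)/2$ are orthogonal projections with $P_+P_-=P_-P_+=0$. With $\mathcal H_\pm=P_\pm\mathcal H$ one has the orthogonal direct sum $\mathcal H=\mathcal H_+\oplus\mathcal H_-$, and $\mathcal H_\pm=\{v:\mathcal Cv=\pm v\}$. 4. If $N\ne2$, then $\mathcal H_+\neq\{0\}$ and $\mathcal H_-\ne\{0\}$. If $N=2$, then $\mathcal C=1$, $\mathcal H_+=\mathcal H$ and $\mathcal H_-=\{0\}$. 5. For each plaquette $p$ in the hyperplane $x^0=\frac12$, the plaquette fields $(\mathcal F_p)_\pm=\mathrm{Tr}\,U_p\pm(\mathrm{Tr}\,U_p)^*$ satisfy $\mathcal C(\mathcal F_p)_\pm=\pm(\mathcal F_p)_\pm$ and $P_\pm(\mathcal F_p)_\pm=(\mathcal F_p)_\pm$. Moreover $(\mathcal F_p)_+\neq0$ in $\mathcal H$, and $(\mathcal F_p)_-\ne0$ in $\mathcal H$ if $N\neq2$. 6. $\big((\mathcal F_{p_1})_+,(\mathcal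 F_{p_2})_-\big)_{\mathcal H}=0$ for all plaquettes $p_1,p_2$ in the hyperplane $x^0=\frac12$. -/

import Mathlib

open MeasureTheory Filter Topology
open scoped ComplexConjugate

noncomputable section

namespace LatticeYM

/-! ### The gauge group -/

/-- The gauge group `SU(N)`. -/
abbrev SU (N : ℕ) : Type := Matrix.specialUnitaryGroup (Fin N) ℂ

instance instMeasurableSpaceSU (N : ℕ) : MeasurableSpace (SU N) := borel _

instance instBorelSpaceSU (N : ℕ) : BorelSpace (SU N) := ⟨rfl⟩

instance instContinuousInvSU (N : ℕ) : ContinuousInv (SU N) where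
  continuous_inv := continuous_induced_rng.mpr (continuous_subtype_val.star)

instance instIsTopologicalGroupSU (N : ℕ) : IsTopologicalGroup (SU N) where

instance instSecondCountableTopologySU (N : ℕ) : SecondCountableTopology (SU N) :=
  haveI : SecondCountableTopology (Matrix (Fin N) (Fin N) ℂ) :=
    inferInstanceAs (SecondCountableTopology (Fin N → Fin N → ℂ))
  inferInstanceAs (SecondCountableTopology
    ((Matrix.specialUnitaryGroup (Fin N) ℂ : Set (Matrix (Fin N) (Fin N) ℂ))))

instance instCompactSpaceSU (N : ℕ) : CompactSpace (SU N) := by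
  have hcl : IsClosed (Matrix.specialUnitaryGroup (Fin N) ℂ :
      Set (Matrix (Fin N) (Fin N) ℂ)) := by
    have h1 : IsClosed (Matrix.unitaryGroup (Fin N) ℂ : Set (Matrix (Fin N) (Fin N) ℂ)) :=
      isClosed_unitary
    have h2 : IsClosed {A : Matrix (Fin N) (Fin N) ℂ | A.det = 1} :=
      isClosed_eq (Continuous.matrix_det continuous_id) continuous_const
    exact h1.inter h2
  have hcp : IsCompact (Set.pi Set.univ (fun _ : Fin N =>
      Set.pi Set.univ (fun _ : Fin N => Metric.closedBall (0 : ℂ) 1))) :=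
    isCompact_univ_pi fun _ => isCompact_univ_pi fun _ => isCompact_closedBall 0 1
  have hK : IsCompact (Matrix.specialUnitaryGroup (Fin N) ℂ :
      Set (Matrix (Fin N) (Fin N) ℂ)) := by
    refine IsCompact.of_isClosed_subset hcp hcl ?_
    intro A hA i _ j _
    simpa using entry_norm_bound_of_unitary (U := A) hA.1 i j
  exact isCompact_iff_compactSpace.mp hK

/-- Normalized Haar measure on `SU(N)`. -/
def haarSU (N : ℕ) : Measure (SU N) := Measure.haarMeasure ⊤

instance instIsProbabilityMeasureHaarSU (N : ℕ) : IsProbabilityMeasure (haarSU N) :=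
  ⟨Measure.haarMeasure_self (K₀ := (⊤ : TopologicalSpace.PositiveCompacts (SU N)))⟩

/-- Entrywise complex conjugation `U ↦ U^*` (not the adjoint) on `SU(N)`. -/
def conjSU {N : ℕ} (U : SU N) : SU N :=
  ⟨U.1.map star, by
    refine Matrix.mem_specialUnitaryGroup_iff.mpr
      ⟨Matrix.map_star_mem_unitaryGroup_iff.mpr U.2.1, ?_⟩
    have h : U.1.det = 1 := (Matrix.mem_specialUnitaryGroup_iff.mp U.2).2
    have h2 := (RingHom.map_det (starRingEnd ℂ) U.1).symm
    rw [h, map_one] at h2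
    exact h2⟩

/-! ### The lattice, with one time direction (index `0`) and `n` space directions -/

/-- Sites of the half-integer shifted lattice `(ℤ + 1/2) × ℤⁿ`: `x : Site n` stands for the point
with time coordinate `x 0 + 1/2` and spatial coordinates `x 1, …, x n`. -/
abbrev Site (n : ℕ) : Type := Fin (n + 1) → ℤ

/-- The site `x + e^μ`. -/
def shift {n : ℕ} (x : Site n) (μ : Fin (n + 1)) : Site n := x + Pi.single μ 1

/-- Time reflection `t (x⁰, x⃗) = (-x⁰, x⃗)`; as `x⁰ = x 0 + 1/2`, it is `x 0 ↦ -1 - x 0`. -/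
def timeReflect {n : ℕ} (x : Site n) : Site n := Function.update x 0 (-1 - x 0)

/-- The pair `(x, μ)` is the positively oriented bond `[x, x + e^μ]`. -/
abbrev Bond (n : ℕ) : Type := Site n × Fin (n + 1)

/-- Configurations of bond variables. -/
abbrev Config (N n : ℕ) : Type := Bond n → SU N

/-- The plaquette variable `U_p = U_{b₁} U_{b₂} U_{b₃}^† U_{b₄}^†` of the plaquette with vertices
`x`, `x + e^μ`, `x + e^μ + e^ν`, `x + e^ν`. -/
def plaquetteVar {N n : ℕ} (U : Config N n) (x : Site n) (μ ν : Fin (n + 1)) : SU N :=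
  U (x, μ) * U (shift x μ, ν) * (U (shift x ν, μ))⁻¹ * (U (x, ν))⁻¹

/-- Finite volumes: finite sets of sites that are invariant under time reflection, ordered by
inclusion. -/
abbrev Volume (n : ℕ) : Type := {Λ : Finset (Site n) // ∀ x ∈ Λ, timeReflect x ∈ Λ}

/-- The Wilson action `∑_{p ⊂ Λ} 2 Re Tr (1 - U_p)`, over all plaquettes with their four vertices
in `Λ` (free boundary conditions). -/
def wilsonAction {N n : ℕ} (Λ : Finset (Site n)) (U : Config N n) : ℝ :=
  ∑ x ∈ Λ, ∑ μ : Fin (n + 1), ∑ ν : Fin (n + 1),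
    if μ < ν ∧ shift x μ ∈ Λ ∧ shift x ν ∈ Λ ∧ shift (shift x μ) ν ∈ Λ then
      2 * (Matrix.trace (1 - (plaquetteVar U x μ ν).1)).re
    else 0

/-- The product of the normalized Haar measures over all bonds. -/
def haarProduct (N n : ℕ) : Measure (Config N n) := Measure.infinitePi fun _ : Bond n => haarSU N

/-- The partition function `Z_Λ`. (Bonds outside `Λ` do not enter the action and integrate
to one.) -/
def partitionFunction (N : ℕ) {n : ℕ} (β : ℝ) (Λ : Finset (Site n)) : ℝ :=
  ∫ U : Config N n, Real.exp (-β * wilsonAction Λ U) ∂(haarProduct N n)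

/-- The finite volume correlation `⟨F⟩_Λ = Z_Λ⁻¹ ∫ F(U) exp(-β A_Λ(U)) dU`. -/
def correlation {N n : ℕ} (β : ℝ) (Λ : Finset (Site n)) (F : C(Config N n, ℂ)) : ℂ :=
  (partitionFunction N β Λ : ℂ)⁻¹ *
    ∫ U : Config N n, F U * (Real.exp (-β * wilsonAction Λ U) : ℂ) ∂(haarProduct N n)

/-- `m` is a thermodynamic limit of the model at coupling `β`: the correlations `⟨F⟩_Λ` converge
to `∫ F dm` as `Λ` exhausts the lattice, at least along some filter of volumes finer than `atTop`
(a subnet). If the full limit `Λ ↗ (ℤ + 1/2) × ℤⁿ` exists, then it is the only such `m`. -/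
def IsThermodynamicLimit {N n : ℕ} (β : ℝ) (m : ProbabilityMeasure (Config N n)) : Prop :=
  ∃ l : Filter (Volume n), l.NeBot ∧ l ≤ atTop ∧ ∀ F : C(Config N n, ℂ),
    Tendsto (fun Λ : Volume n => correlation β Λ.1 F) l
      (𝓝 (∫ U, F U ∂(m : Measure (Config N n))))

/-! ### Time reflection, gauge transformations and charge conjugation of configurations -/

/-- The time reflected configuration, `g_{uv} ↦ g_{(tu)(tv)}` with `g_{vu} = g_{uv}⁻¹`: a spatial
bond `[x, x + e^μ]` is sent to `[tx, tx + e^μ]`, and a temporal bond `[x, x + e⁰]` to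
`[tx, tx - e⁰]`, the bond `[t(x + e⁰), t(x + e⁰) + e⁰]` with the reversed orientation. -/
def reflectConfig (N n : ℕ) : C(Config N n, Config N n) where
  toFun U b := if b.2 = 0 then (U (timeReflect (shift b.1 0), 0))⁻¹ else U (timeReflect b.1, b.2)
  continuous_toFun := by
    refine continuous_pi fun b => ?_
    by_cases hb : b.2 = 0
    · simp only [hb, if_true]
      exact (continuous_apply _).inv
    · simp only [hb, if_false]
      exact continuous_apply _

/-- The gauge transformation `U_{[x, x + e^μ]} ↦ h(x) U_{[x, x + e^μ]} h(x + e^μ)⁻¹`. -/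
def gaugeConfig {N n : ℕ} (h : Site n → SU N) (U : Config N n) : Config N n :=
  fun b => h b.1 * U b * (h (shift b.1 b.2))⁻¹

/-- The configuration `{U_b^*}` of entrywise complex conjugates. -/
def conjConfig (N n : ℕ) : C(Config N n, Config N n) where
  toFun U b := conjSU (U b)
  continuous_toFun := by
    refine continuous_pi fun b => continuous_induced_rng.mpr ?_
    exact Continuous.matrix_map (continuous_subtype_val.comp (continuous_apply b)) continuous_star

/-! ### The functions from which the physical Hilbert space is built -/

/-- The matrix element `U ↦ (U_b)_{ij}`. -/
def matrixElement {N n : ℕ} (b : Bond n) (i j : Fin N) : C(Config N n, ℂ) where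
  toFun U := (U b).1 i j
  continuous_toFun :=
    (continuous_subtype_val.comp (continuous_apply b)).matrix_elem i j

/-- The matrix element `U ↦ ((U_b)_{ij})^*`, that is `(U_b⁻¹)_{ji}`. -/
def matrixElementConj {N n : ℕ} (b : Bond n) (i j : Fin N) : C(Config N n, ℂ) :=
  star (matrixElement b i j)

/-- The bonds with both ends in the hyperplane `x⁰ = 1/2`. -/
def halfBonds (n : ℕ) : Set (Bond n) := {b | b.1 0 = 0 ∧ b.2 ≠ 0}

/-- Finite linear combinations of monomials in the matrix elements of the bond variables, and of
their inverses, of bonds in the hyperplane `x⁰ = 1/2`. -/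
def halfPolynomials (N n : ℕ) : Subalgebra ℂ C(Config N n, ℂ) :=
  Algebra.adjoin ℂ {F | ∃ b ∈ halfBonds n, ∃ i j : Fin N,
    F = matrixElement b i j ∨ F = matrixElementConj b i j}

/-- Gauge invariant functions. -/
def gaugeInvariant (N n : ℕ) : Subalgebra ℂ C(Config N n, ℂ) where
  carrier := {F | ∀ (h : Site n → SU N) (U : Config N n), F (gaugeConfig h U) = F U}
  mul_mem' hF hG h U := by simp [hF h U, hG h U]
  add_mem' hF hG h U := by simp [hF h U, hG h U]
  algebraMap_mem' c h U := by simp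

/-- The gauge invariant functions with support restricted to `x⁰ = 1/2`. -/
def observables (N n : ℕ) : Subalgebra ℂ C(Config N n, ℂ) :=
  halfPolynomials N n ⊓ gaugeInvariant N n

/-! ### The physical Hilbert space -/

/-- The form `(G, F) ↦ ⟨F ΘG⟩`, with `(ΘG)(U) = G(reflected U)^*`. -/
def osForm {N n : ℕ} (m : ProbabilityMeasure (Config N n)) (G F : C(Config N n, ℂ)) : ℂ :=
  ∫ U, F U * conj (G (reflectConfig N n U)) ∂(m : Measure (Config N n))

/-- Reflection positivity: `⟨F ΘF⟩` is real and nonnegative. -/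
def IsReflectionPositive {N n : ℕ} (m : ProbabilityMeasure (Config N n)) : Prop :=
  ∀ F ∈ observables N n, 0 ≤ (osForm m F F).re ∧ (osForm m F F).im = 0

lemma osForm_integrable {N n : ℕ} (m : ProbabilityMeasure (Config N n))
    (G F : C(Config N n, ℂ)) :
    Integrable (fun U => F U * conj (G (reflectConfig N n U))) (m : Measure (Config N n)) := by
  have h : Continuous fun U => F U * conj (G (reflectConfig N n U)) :=
    F.continuous.mul (Complex.continuous_conj.comp (G.continuous.comp (reflectConfig N n).continuous))
  exact h.integrable_of_hasCompactSupport (HasCompactSupport.of_compactSpace _)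

lemma osForm_add_left {N n : ℕ} (m : ProbabilityMeasure (Config N n))
    (G G' F : C(Config N n, ℂ)) : osForm m (G + G') F = osForm m G F + osForm m G' F := by
  unfold osForm
  rw [← integral_add (osForm_integrable m G F) (osForm_integrable m G' F)]
  congr 1
  ext U
  simp [mul_add]

lemma osForm_add_right {N n : ℕ} (m : ProbabilityMeasure (Config N n))
    (G F F' : C(Config N n, ℂ)) : osForm m G (F + F') = osForm m G F + osForm m G F' := by
  unfold osForm
  rw [← integral_add (osForm_integrable m G F) (osForm_integrable m G F')]
  congr 1
  ext U
  simp [add_mul]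

lemma osForm_smul_left {N n : ℕ} (m : ProbabilityMeasure (Config N n)) (c : ℂ)
    (G F : C(Config N n, ℂ)) : osForm m (c • G) F = conj c * osForm m G F := by
  unfold osForm
  rw [← integral_const_mul]
  congr 1
  ext U
  simp only [ContinuousMap.smul_apply, smul_eq_mul, map_mul]
  ring

lemma osForm_smul_right {N n : ℕ} (m : ProbabilityMeasure (Config N n)) (c : ℂ)
    (G F : C(Config N n, ℂ)) : osForm m G (c • F) = c * osForm m G F := by
  unfold osForm
  rw [← integral_const_mul]
  congr 1
  ext U
  simp only [ContinuousMap.smul_apply, smul_eq_mul]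
  ring

lemma IsReflectionPositive.conj_symm {N n : ℕ} {m : ProbabilityMeasure (Config N n)}
    (h : IsReflectionPositive m) {F G : C(Config N n, ℂ)} (hF : F ∈ observables N n)
    (hG : G ∈ observables N n) : conj (osForm m G F) = osForm m F G := by
  have h1 := (h (F + G) (add_mem hF hG)).2
  have h2 := (h (F + Complex.I • G) (add_mem hF (Subalgebra.smul_mem _ hG _))).2
  have hf := (h F hF).2
  have hg := (h G hG).2
  simp only [osForm_add_left, osForm_add_right, osForm_smul_left, osForm_smul_right,
    Complex.add_im, Complex.add_re, Complex.mul_im, Complex.mul_re, Complex.conj_I, Complex.neg_re,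
    Complex.neg_im, Complex.I_re, Complex.I_im] at h1 h2
  refine Complex.ext ?_ ?_
  · simp only [Complex.conj_re]
    linarith
  · simp only [Complex.conj_im]
    linarith

/-- The space of observables, to be equipped with the inner product `(G, F) = ⟨F ΘG⟩`. -/
def PreHilbert {N n : ℕ} (m : ProbabilityMeasure (Config N n)) (_h : IsReflectionPositive m) :
    Type := observables N n

section PreHilbert

variable {N n : ℕ} {m : ProbabilityMeasure (Config N n)} (h : IsReflectionPositive m)

instance instAddCommGroupPreHilbert : AddCommGroup (PreHilbert m h) :=
  inferInstanceAs (AddCommGroup (observables N n))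

instance instModulePreHilbert : Module ℂ (PreHilbert m h) :=
  inferInstanceAs (Module ℂ (observables N n))

instance instCorePreHilbert : PreInnerProductSpace.Core ℂ (PreHilbert m h) where
  inner G F := osForm m (Subtype.val (p := (· ∈ observables N n)) G)
    (Subtype.val (p := (· ∈ observables N n)) F)
  conj_inner_symm F G :=
    h.conj_symm (Subtype.property (p := (· ∈ observables N n)) F)
      (Subtype.property (p := (· ∈ observables N n)) G)
  re_inner_nonneg F := (h _ (Subtype.property (p := (· ∈ observables N n)) F)).1
  add_left _ _ _ := osForm_add_left m _ _ _
  smul_left _ _ _ := osForm_smul_left m _ _ _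

instance instSeminormedAddCommGroupPreHilbert : SeminormedAddCommGroup (PreHilbert m h) :=
  InnerProductSpace.Core.toSeminormedAddCommGroup (𝕜 := ℂ)

instance instInnerProductSpacePreHilbert : InnerProductSpace ℂ (PreHilbert m h) :=
  InnerProductSpace.ofCore (instCorePreHilbert h)

end PreHilbert

/-- The physical Hilbert space `ℋ`: the (Hausdorff) completion of the space of observables, that
is, the completion of its quotient by the null space `{F | ⟨F ΘF⟩ = 0}`. -/
abbrev PhysicalSpace {N n : ℕ} (m : ProbabilityMeasure (Config N n))
    (h : IsReflectionPositive m) : Type :=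
  UniformSpace.Completion (PreHilbert m h)

/-- The vector of `ℋ` defined by an observable. -/
def vec {N n : ℕ} {m : ProbabilityMeasure (Config N n)} (h : IsReflectionPositive m)
    (F : observables N n) : PhysicalSpace m h :=
  UniformSpace.Completion.coe' (show PreHilbert m h from F)

lemma inner_vec {N n : ℕ} {m : ProbabilityMeasure (Config N n)} (h : IsReflectionPositive m)
    (G F : observables N n) :
    inner ℂ (vec h G) (vec h F) = osForm m (G : C(Config N n, ℂ)) (F : C(Config N n, ℂ)) :=
  UniformSpace.Completion.inner_coe _ _

/-! ### Charge conjugation -/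

/-- Charge conjugation of functions, `F({U_b}) ↦ F({U_b^*})`. -/
def chargeConjFun (N n : ℕ) : C(Config N n, ℂ) →ₐ[ℂ] C(Config N n, ℂ) :=
  ContinuousMap.compRightAlgHom ℂ ℂ (conjConfig N n)

lemma chargeConjFun_matrixElement {N n : ℕ} (b : Bond n) (i j : Fin N) :
    chargeConjFun N n (matrixElement b i j) = matrixElementConj b i j := rfl

lemma chargeConjFun_matrixElementConj {N n : ℕ} (b : Bond n) (i j : Fin N) :
    chargeConjFun N n (matrixElementConj b i j) = matrixElement b i j := by
  ext U
  exact star_star ((U b).1 i j)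

lemma conjSU_mul {N : ℕ} (A B : SU N) : conjSU (A * B) = conjSU A * conjSU B :=
  Subtype.ext (Matrix.map_mul (f := starRingEnd ℂ))

lemma conjSU_inv {N : ℕ} (A : SU N) : conjSU A⁻¹ = (conjSU A)⁻¹ := rfl

lemma chargeConjFun_mem {N n : ℕ} {F : C(Config N n, ℂ)} (hF : F ∈ observables N n) :
    chargeConjFun N n F ∈ observables N n := by
  refine ⟨?_, fun g U => ?_⟩
  · have hle : halfPolynomials N n ≤ (halfPolynomials N n).comap (chargeConjFun N n) := by
      refine Algebra.adjoin_le ?_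
      rintro _ ⟨b, hb, i, j, rfl | rfl⟩
      · exact Algebra.subset_adjoin ⟨b, hb, i, j, Or.inr (chargeConjFun_matrixElement b i j)⟩
      · exact Algebra.subset_adjoin ⟨b, hb, i, j, Or.inl (chargeConjFun_matrixElementConj b i j)⟩
    exact hle hF.1
  · have hU : conjConfig N n (gaugeConfig g U) =
        gaugeConfig (fun x => conjSU (g x)) (conjConfig N n U) := by
      funext b
      change conjSU (g b.1 * U b * (g (shift b.1 b.2))⁻¹) = _
      rw [conjSU_mul, conjSU_mul, conjSU_inv]
      rfl
    change F (conjConfig N n (gaugeConfig g U)) = F (conjConfig N n U)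
    rw [hU]
    exact hF.2 _ _

/-- Charge conjugation of observables. -/
def chargeConj {N n : ℕ} (F : observables N n) : observables N n :=
  ⟨chargeConjFun N n F, chargeConjFun_mem F.2⟩

/-- `C` is the charge conjugation operator on `ℋ`: the bounded linear operator that acts by
`F({U_b}) ↦ F({U_b^*})` on the dense set of vectors given by observables. -/
def IsChargeConjugation {N n : ℕ} {m : ProbabilityMeasure (Config N n)}
    (h : IsReflectionPositive m) (C : PhysicalSpace m h →L[ℂ] PhysicalSpace m h) : Prop :=
  ∀ F : observables N n, C (vec h F) = vec h (chargeConj F)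

/-- `P_+ = (1 + C) / 2`. -/
def projPlus {H : Type*} [NormedAddCommGroup H] [InnerProductSpace ℂ H] (C : H →L[ℂ] H) :
    H →L[ℂ] H := (1 / 2 : ℂ) • (1 + C)

/-- `P_- = (1 - C) / 2`. -/
def projMinus {H : Type*} [NormedAddCommGroup H] [InnerProductSpace ℂ H] (C : H →L[ℂ] H) :
    H →L[ℂ] H := (1 / 2 : ℂ) • (1 - C)

/-- The charge conjugation sector `ℋ_+ = P_+ ℋ`. -/
def sectorPlus {H : Type*} [NormedAddCommGroup H] [InnerProductSpace ℂ H] (C : H →L[ℂ] H) :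
    Submodule ℂ H := LinearMap.range (projPlus C : H →ₗ[ℂ] H)

/-- The charge conjugation sector `ℋ_- = P_- ℋ`. -/
def sectorMinus {H : Type*} [NormedAddCommGroup H] [InnerProductSpace ℂ H] (C : H →L[ℂ] H) :
    Submodule ℂ H := LinearMap.range (projMinus C : H →ₗ[ℂ] H)

/-! ### Plaquette fields -/

/-- The plaquettes `p_{μν}(x)`, `μ < ν`, contained in the hyperplane `x⁰ = 1/2`. -/
structure HalfPlaquette (n : ℕ) where
  site : Site n
  dir₁ : Fin (n + 1)
  dir₂ : Fin (n + 1)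
  time_eq : site 0 = 0
  dir₁_pos : 0 < dir₁
  dir_lt : dir₁ < dir₂

/-- The function `U ↦ Tr U_p`. -/
def tracePlaquette (N : ℕ) {n : ℕ} (p : HalfPlaquette n) : C(Config N n, ℂ) where
  toFun U := Matrix.trace (plaquetteVar U p.site p.dir₁ p.dir₂).1
  continuous_toFun := by
    refine Continuous.matrix_trace (continuous_subtype_val.comp ?_)
    unfold plaquetteVar
    fun_prop

lemma tracePlaquette_eq (N : ℕ) {n : ℕ} (p : HalfPlaquette n) :
    tracePlaquette N p = ∑ i : Fin N, ∑ j : Fin N, ∑ k : Fin N, ∑ l : Fin N,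
      matrixElement (p.site, p.dir₁) i l * matrixElement (shift p.site p.dir₁, p.dir₂) l k *
        matrixElementConj (shift p.site p.dir₂, p.dir₁) j k *
        matrixElementConj (p.site, p.dir₂) i j := by
  ext U
  simp only [ContinuousMap.coe_sum, Finset.sum_apply, ContinuousMap.mul_apply]
  change Matrix.trace ((U (p.site, p.dir₁)).1 * (U (shift p.site p.dir₁, p.dir₂)).1 *
    star (U (shift p.site p.dir₂, p.dir₁)).1 * star (U (p.site, p.dir₂)).1) = _
  simp only [Matrix.trace, Matrix.diag, Matrix.mul_apply, Finset.sum_mul]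
  rfl

lemma shift_comm {n : ℕ} (x : Site n) (μ ν : Fin (n + 1)) :
    shift (shift x μ) ν = shift (shift x ν) μ := add_right_comm _ _ _

lemma tracePlaquette_mem (N : ℕ) {n : ℕ} (p : HalfPlaquette n) :
    tracePlaquette N p ∈ observables N n := by
  have h1 : p.dir₁ ≠ 0 := p.dir₁_pos.ne'
  have h2 : p.dir₂ ≠ 0 := (p.dir₁_pos.trans p.dir_lt).ne'
  have s1 : shift p.site p.dir₁ 0 = 0 := by simp [shift, p.time_eq, h1.symm]
  have s2 : shift p.site p.dir₂ 0 = 0 := by simp [shift, p.time_eq, h2.symm]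
  refine ⟨?_, fun g U => ?_⟩
  · rw [tracePlaquette_eq]
    refine sum_mem fun i _ => sum_mem fun j _ => sum_mem fun k _ => sum_mem fun l _ => ?_
    refine mul_mem (mul_mem (mul_mem ?_ ?_) ?_) ?_
    · exact Algebra.subset_adjoin ⟨_, ⟨p.time_eq, h1⟩, _, _, Or.inl rfl⟩
    · exact Algebra.subset_adjoin ⟨_, ⟨s1, h2⟩, _, _, Or.inl rfl⟩
    · exact Algebra.subset_adjoin ⟨_, ⟨s2, h1⟩, _, _, Or.inr rfl⟩
    · exact Algebra.subset_adjoin ⟨_, ⟨p.time_eq, h2⟩, _, _, Or.inr rfl⟩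
  · have hp : plaquetteVar (gaugeConfig g U) p.site p.dir₁ p.dir₂ =
        g p.site * plaquetteVar U p.site p.dir₁ p.dir₂ * (g p.site)⁻¹ := by
      simp only [plaquetteVar, gaugeConfig, shift_comm p.site p.dir₂ p.dir₁]
      group
    change Matrix.trace (plaquetteVar (gaugeConfig g U) p.site p.dir₁ p.dir₂).1 =
      Matrix.trace (plaquetteVar U p.site p.dir₁ p.dir₂).1
    rw [hp]
    change Matrix.trace ((g p.site).1 * (plaquetteVar U p.site p.dir₁ p.dir₂).1 *
      ((g p.site)⁻¹ : SU N).1) = _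
    rw [Matrix.trace_mul_comm, ← mul_assoc]
    change Matrix.trace (((g p.site)⁻¹ * g p.site : SU N).1 * _) = _
    rw [inv_mul_cancel]
    change Matrix.trace (1 * _) = _
    rw [one_mul]

/-- `Tr U_p` as an observable. -/
def traceObs (N : ℕ) {n : ℕ} (p : HalfPlaquette n) : observables N n :=
  ⟨tracePlaquette N p, tracePlaquette_mem N p⟩

lemma star_tracePlaquette (N : ℕ) {n : ℕ} (p : HalfPlaquette n) :
    chargeConjFun N n (tracePlaquette N p) = star (tracePlaquette N p) := by
  rw [tracePlaquette_eq]
  simp only [map_sum, map_mul, star_sum, star_mul', chargeConjFun_matrixElement,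
    chargeConjFun_matrixElementConj]
  simp only [matrixElementConj, star_star]

/-- `(Tr U_p)^*` as an observable. -/
def traceObsConj (N : ℕ) {n : ℕ} (p : HalfPlaquette n) : observables N n :=
  ⟨star (tracePlaquette N p),
    star_tracePlaquette N p ▸ chargeConjFun_mem (tracePlaquette_mem N p)⟩

/-- The plaquette field `(ℱ_p)_+ = Tr U_p + (Tr U_p)^*`. -/
def plaquettePlus (N : ℕ) {n : ℕ} (p : HalfPlaquette n) : observables N n :=
  traceObs N p + traceObsConj N p

/-- The plaquette field `(ℱ_p)_- = Tr U_p - (Tr U_p)^*`. -/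
def plaquetteMinus (N : ℕ) {n : ℕ} (p : HalfPlaquette n) : observables N n :=
  traceObs N p - traceObsConj N p

end LatticeYM

end

namespace LatticeYM

/-! ### Invariance of the product measure -/

/-! Reflection positivity. Gauge invariance allows the bonds crossing `x⁰ = 0` to be set to `1`
(`integral_foldConfig`). A configuration is then a pair `(V, V')` of independent half-space
configurations, the second one reflected, and the action splits as `A₊(V) + A₊(V')` plus crossing
plaquettes of energy `2N - 2 Re Tr (V_b V'_b⁻¹)` (`wilsonAction_foldConfig`). Since `2 Re Tr (V_b
V'_b⁻¹)` is a sum of kernels `u(V) u(V')^*`, its exponential is a positive definite kernel, by Schur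
products and the exponential series. As `F ΘF` becomes `F(V) F(V')^*`, every `⟨F ΘF⟩_Λ` is
nonnegative, and so is its limit. Limits exist because the probability measures on the compact
configuration space form a compact space.

Charge conjugation. Entrywise conjugation preserves Haar measure and the action and commutes with
the reflection. It therefore preserves the form and extends by density to an isometric involution,
which is unitary and self-adjoint; the statements on `P_±` are algebra of such involutions. For `N =
2`, conjugation is inner, hence a gauge transformation, and acts trivially on gauge invariant
functions.

Nonvanishing of the plaquette fields is the analytic point: `⟨F ΘF⟩` must not tend to `0` with the
volume. Order kernels by positive definiteness. If `F^*` is a polynomial in the bonds of a finite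
set `S`, then `F^* ⊗ F` is dominated by a multiple of the coupling on `S` at strength `β/2`
(`bondPolynomials_le_dominated`). Absorbing `F^* ⊗ F` into the test function, and restoring the
missing half of the coupling by a pointwise bound valid because `|F|² ≥ 0`, gives `⟨|F|² Θ|F|²⟩_Λ ≤
c ⟨F ΘF⟩_Λ` with `c` independent of `Λ` (`exists_correlation_osFun_le`). The left side is the mean
of a nonnegative local function, and Gibbs measures dominate a fixed multiple of Haar measure on
finitely many bonds (`exists_lowerBound_expectation`). So `⟨F ΘF⟩ > 0` as soon as `F` is nonzero at
some configuration and at its reflection (`osForm_self_pos`). For `(ℱ_p)_±` a reflection invariant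
configuration with prescribed `U_p` suffices: `U_p = 1`, or a centre element with non-real trace,
which exists for `N ≥ 3`. -/

instance instIsProbabilityMeasureHaarProduct (N n : ℕ) :
    IsProbabilityMeasure (haarProduct N n) := by
  unfold haarProduct; infer_instance

instance instIsHaarMeasureHaarSU (N : ℕ) : (haarSU N).IsHaarMeasure := by
  unfold haarSU; infer_instance

lemma measurePreserving_haarSU_of_hom {N : ℕ} (f : SU N →* SU N) (hf : Continuous f)
    (hs : Function.Surjective f) : MeasurePreserving f (haarSU N) (haarSU N) :=
  f.measurePreserving hf hs rfl

/-- The map is left translation by `h * g` followed by conjugation by `h⁻¹`, a surjective continuous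
homomorphism; right invariance is not presupposed but follows. -/
lemma measurePreserving_mul_mul {N : ℕ} (g h : SU N) :
    MeasurePreserving (fun u => g * u * h) (haarSU N) (haarSU N) := by
  have h1 : MeasurePreserving (MulAut.conj h⁻¹).toMonoidHom (haarSU N) (haarSU N) :=
    measurePreserving_haarSU_of_hom _
      (by change Continuous fun u => h⁻¹ * u * (h⁻¹)⁻¹; fun_prop) (MulAut.conj h⁻¹).surjective
  have h3 := h1.comp (measurePreserving_mul_left (haarSU N) (h * g))
  convert h3 using 1
  ext1 u
  change g * u * h = h⁻¹ * (h * g * u) * (h⁻¹)⁻¹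
  group

instance instIsMulRightInvariantHaarSU (N : ℕ) : (haarSU N).IsMulRightInvariant :=
  ⟨fun g => by simpa using (measurePreserving_mul_mul 1 g).map_eq⟩

/-- The inverted measure is left invariant too, hence proportional to Haar measure, and comparing
total masses makes the factor `1`. -/
instance instIsInvInvariantHaarSU (N : ℕ) : (haarSU N).IsInvInvariant := by
  constructor
  have h2 : IsProbabilityMeasure (haarSU N).inv :=
    Measure.isProbabilityMeasure_map measurable_inv.aemeasurable
  have h := Measure.isMulInvariant_eq_smul_of_compactSpace (haarSU N).inv (haarSU N)
  have h3 := congrArg (fun μ => μ Set.univ) h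
  simp only [measure_univ, Measure.smul_apply, ENNReal.smul_def, smul_eq_mul, mul_one] at h3
  rw [h]
  ext s
  simp [ENNReal.smul_def, ← h3]

lemma continuous_conjSU {N : ℕ} : Continuous (conjSU : SU N → SU N) :=
  continuous_induced_rng.mpr (Continuous.matrix_map continuous_subtype_val continuous_star)

lemma conjSU_conjSU {N : ℕ} (U : SU N) : conjSU (conjSU U) = U :=
  Subtype.ext (by ext i j; exact star_star _)

lemma measurePreserving_conjSU (N : ℕ) :
    MeasurePreserving (conjSU : SU N → SU N) (haarSU N) (haarSU N) :=
  measurePreserving_haarSU_of_hom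
    { toFun := conjSU, map_one' := Subtype.ext (by simp [conjSU]), map_mul' := conjSU_mul }
    continuous_conjSU (fun U => ⟨conjSU U, conjSU_conjSU U⟩)

/-- An infinite product measure is determined by finite cylinders, which such maps only permute and
transform factor by factor. Reflection, conjugation and gauge transformations are all of this kind.
-/
lemma measurePreserving_bondwise {N n : ℕ} (e : Bond n ≃ Bond n) (f : Bond n → SU N → SU N)
    (hf : ∀ b, MeasurePreserving (f b) (haarSU N) (haarSU N)) :
    MeasurePreserving (fun (U : Config N n) b => f b (U (e b)))
      (haarProduct N n) (haarProduct N n) := by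
  have hm : Measurable (fun (U : Config N n) b => f b (U (e b))) :=
    measurable_pi_iff.mpr fun b => (hf b).measurable.comp (measurable_pi_apply _)
  refine ⟨hm, ?_⟩
  refine Measure.eq_infinitePi _ fun s t ht => ?_
  rw [Measure.map_apply hm (.pi s.countable_toSet fun _ _ => ht _)]
  have : (fun (U : Config N n) b => f b (U (e b))) ⁻¹' ((s : Set (Bond n)).pi t) =
      ((s.map e.toEmbedding : Finset (Bond n)) : Set (Bond n)).pi
        (fun c => f (e.symm c) ⁻¹' (t (e.symm c))) := by
    ext x
    simp only [Set.mem_preimage, Set.mem_pi, Finset.mem_coe, Finset.mem_map_equiv]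
    exact ⟨fun h c hc => by simpa using h _ hc, fun h b hb => by simpa using h (e b) (by simpa)⟩
  rw [this, haarProduct, Measure.infinitePi_pi _ fun i _ => (hf _).measurable (ht _),
    Finset.prod_map]
  refine Finset.prod_congr rfl fun b _ => ?_
  simp only [Equiv.coe_toEmbedding, Equiv.symm_apply_apply]
  exact (hf b).measure_preimage (ht b).nullMeasurableSet

lemma timeReflect_timeReflect {n : ℕ} (x : Site n) : timeReflect (timeReflect x) = x := by
  simp [timeReflect]

lemma timeReflect_shift {n : ℕ} (x : Site n) {μ : Fin (n + 1)} (hμ : μ ≠ 0) :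
    timeReflect (shift x μ) = shift (timeReflect x) μ := by
  ext i
  by_cases hi : i = 0
  · subst hi; simp [timeReflect, shift, hμ.symm]
  · simp [timeReflect, shift, hi]

lemma shift_timeReflect_shift {n : ℕ} (x : Site n) :
    shift (timeReflect (shift x 0)) 0 = timeReflect x := by
  ext i
  by_cases hi : i = 0
  · subst hi; simp [timeReflect, shift]; ring
  · simp [timeReflect, shift, hi]

/-- The bond onto which time reflection maps the (unoriented) bond `b`. -/
def reflectBond {n : ℕ} (b : Bond n) : Bond n :=
  (if b.2 = 0 then timeReflect (shift b.1 0) else timeReflect b.1, b.2)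

lemma reflectBond_reflectBond {n : ℕ} (b : Bond n) : reflectBond (reflectBond b) = b := by
  obtain ⟨x, μ⟩ := b
  by_cases h : μ = 0
  · simp [reflectBond, h, shift_timeReflect_shift, timeReflect_timeReflect]
  · simp [reflectBond, h, timeReflect_timeReflect]

lemma reflectConfig_apply {N n : ℕ} (U : Config N n) (b : Bond n) :
    reflectConfig N n U b = if b.2 = 0 then (U (reflectBond b))⁻¹ else U (reflectBond b) := by
  obtain ⟨x, μ⟩ := b
  by_cases h : μ = 0 <;> simp [reflectConfig, reflectBond, h]

lemma measurePreserving_reflectConfig (N n : ℕ) :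
    MeasurePreserving (reflectConfig N n) (haarProduct N n) (haarProduct N n) := by
  have h := measurePreserving_bondwise (N := N)
    (Function.Involutive.toPerm reflectBond (reflectBond_reflectBond (n := n)))
    (fun b u => if b.2 = 0 then u⁻¹ else u) (fun b => by
      by_cases hb : b.2 = 0
      · simpa [hb] using Measure.measurePreserving_inv (haarSU N)
      · simpa [hb] using! MeasurePreserving.id (haarSU N))
  convert h using 1
  ext1 U; ext1 b
  exact reflectConfig_apply U b

lemma measurePreserving_conjConfig (N n : ℕ) :
    MeasurePreserving (conjConfig N n) (haarProduct N n) (haarProduct N n) :=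
  measurePreserving_bondwise (Equiv.refl _) (fun _ => conjSU) fun _ => measurePreserving_conjSU N

lemma measurePreserving_gaugeConfig {N n : ℕ} (h : Site n → SU N) :
    MeasurePreserving (gaugeConfig h : Config N n → Config N n)
      (haarProduct N n) (haarProduct N n) :=
  measurePreserving_bondwise (Equiv.refl _) (fun b u => h b.1 * u * (h (shift b.1 b.2))⁻¹)
    fun _ => measurePreserving_mul_mul _ _

/-! ### Independence of disjoint sets of bonds -/

open Classical in
/-- The configuration that agrees with `U` on `S` and with `V` off `S`. -/
noncomputable def splice {N n : ℕ} (S : Set (Bond n)) (U V : Config N n) : Config N n :=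
  fun b => if b ∈ S then U b else V b

lemma splice_of_mem {N n : ℕ} {S : Set (Bond n)} (U V : Config N n) {b : Bond n} (hb : b ∈ S) :
    splice S U V b = U b := if_pos hb

lemma splice_of_notMem {N n : ℕ} {S : Set (Bond n)} (U V : Config N n) {b : Bond n}
    (hb : b ∉ S) : splice S U V b = V b := if_neg hb

@[fun_prop]
lemma continuous_splice {N n : ℕ} {X : Type*} [TopologicalSpace X] (S : Set (Bond n))
    {f g : X → Config N n} (hf : Continuous f) (hg : Continuous g) :
    Continuous fun x => splice S (f x) (g x) := by
  refine continuous_pi fun b => ?_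
  by_cases hb : b ∈ S
  · simp only [splice_of_mem _ _ hb]; fun_prop
  · simp only [splice_of_notMem _ _ hb]; fun_prop

/-- This is independence of the bonds in `S` from those off `S`: the preimage of a cylinder is a
rectangle whose two sides constrain complementary sets of bonds. -/
lemma measurePreserving_splice (N : ℕ) {n : ℕ} (S : Set (Bond n)) :
    MeasurePreserving (fun p : Config N n × Config N n => splice S p.1 p.2)
      ((haarProduct N n).prod (haarProduct N n)) (haarProduct N n) := by
  classical
  have hm : Measurable (fun p : Config N n × Config N n => splice S p.1 p.2) :=
    (continuous_splice S continuous_fst continuous_snd).measurable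
  refine ⟨hm, ?_⟩
  refine Measure.eq_infinitePi _ fun s t ht => ?_
  rw [Measure.map_apply hm (.pi s.countable_toSet fun _ _ => ht _)]
  have : (fun p : Config N n × Config N n => splice S p.1 p.2) ⁻¹' ((s : Set (Bond n)).pi t) =
      (((s.filter (· ∈ S) : Finset (Bond n)) : Set (Bond n)).pi t) ×ˢ
      (((s.filter (· ∉ S) : Finset (Bond n)) : Set (Bond n)).pi t) := by
    ext x
    simp only [Set.mem_preimage, Set.mem_pi, Finset.mem_coe, Set.mem_prod, Finset.mem_filter,
      splice]
    grind
  rw [this, Measure.prod_prod, haarProduct, Measure.infinitePi_pi _ fun i _ => ht _,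
    Measure.infinitePi_pi _ fun i _ => ht _, Finset.prod_filter_mul_prod_filter_not]

lemma integrable_of_continuous {X E : Type*} [TopologicalSpace X] [CompactSpace X]
    [MeasurableSpace X] [OpensMeasurableSpace X] [SecondCountableTopology X]
    [NormedAddCommGroup E]
    (μ : Measure X) [IsFiniteMeasure μ] {f : X → E} (hf : Continuous f) : Integrable f μ :=
  hf.integrable_of_hasCompactSupport (HasCompactSupport.of_compactSpace _)

/-- Fubini in a form that holds the variables on `S` fixed as parameters while the others undergo a
change of variables. -/
lemma integral_splice {N n : ℕ} {E : Type*} [NormedAddCommGroup E] [NormedSpace ℝ E]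
    (S : Set (Bond n)) {f : Config N n → E} (hf : Continuous f) :
    ∫ U, f U ∂(haarProduct N n) =
      ∫ U, ∫ V, f (splice S U V) ∂(haarProduct N n) ∂(haarProduct N n) := by
  have h := measurePreserving_splice N S
  conv_lhs => rw [← h.map_eq, integral_map h.measurable.aemeasurable hf.aestronglyMeasurable]
  refine integral_prod _ (integrable_of_continuous _ ?_)
  exact hf.comp (continuous_splice S continuous_fst continuous_snd)

lemma integral_comp_of_measurePreserving {N n : ℕ} {E : Type*} [NormedAddCommGroup E]
    [NormedSpace ℝ E] {T : Config N n → Config N n}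
    (hT : MeasurePreserving T (haarProduct N n) (haarProduct N n)) {f : Config N n → E}
    (hf : Continuous f) :
    ∫ U, f (T U) ∂(haarProduct N n) = ∫ U, f U ∂(haarProduct N n) := by
  conv_rhs => rw [← hT.map_eq, integral_map hT.measurable.aemeasurable hf.aestronglyMeasurable]

/-! ### Folding the lattice along the reflection hyperplane -/

lemma timeReflect_apply_zero {n : ℕ} (x : Site n) : timeReflect x 0 = -1 - x 0 := by
  simp [timeReflect]

lemma shift_zero_apply_zero {n : ℕ} (x : Site n) : shift x 0 0 = x 0 + 1 := by
  simp [shift]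

lemma shift_apply_zero {n : ℕ} (x : Site n) {μ : Fin (n + 1)} (hμ : μ ≠ 0) :
    shift x μ 0 = x 0 := by
  simp [shift, hμ.symm]

lemma timeReflect_eq_shift {n : ℕ} {x : Site n} (hx : x 0 = -1) :
    timeReflect x = shift x 0 := by
  ext i
  by_cases hi : i = 0
  · subst hi; simp [timeReflect, shift, hx]
  · simp [timeReflect, shift, hi]

lemma gaugeConfig_reflectConfig {N n : ℕ} (h : Site n → SU N) (V : Config N n) :
    gaugeConfig h (reflectConfig N n V) =
      reflectConfig N n (gaugeConfig (fun x => h (timeReflect x)) V) := by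
  ext1 ⟨x, μ⟩
  by_cases hμ : μ = 0
  · subst hμ
    simp [gaugeConfig, reflectConfig_apply, reflectBond, timeReflect_timeReflect,
      shift_timeReflect_shift, mul_assoc]
  · simp [gaugeConfig, reflectConfig_apply, reflectBond, timeReflect_timeReflect, hμ,
      ← timeReflect_shift]

lemma conjConfig_reflectConfig {N n : ℕ} (V : Config N n) :
    conjConfig N n (reflectConfig N n V) = reflectConfig N n (conjConfig N n V) := by
  ext1 b
  change conjSU (reflectConfig N n V b) = _
  rw [reflectConfig_apply, reflectConfig_apply]
  split_ifs
  · rfl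
  · rfl

/-- The bonds with both ends in the half space `x⁰ > 0`. -/
def upperBonds (n : ℕ) : Set (Bond n) := {b | 0 ≤ b.1 0}

/-- The bonds crossing the hyperplane `x⁰ = 0`. -/
def crossingBonds (n : ℕ) : Set (Bond n) := {b | b.1 0 = -1 ∧ b.2 = 0}

/-- The configuration that agrees with `V` in the upper half space, with the reflection of `V'` in
the lower half space, and is `1` on the bonds between them. -/
noncomputable def foldConfig {N n : ℕ} (V V' : Config N n) : Config N n :=
  splice (crossingBonds n) 1 (splice (upperBonds n) V (reflectConfig N n V'))

@[fun_prop]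
lemma continuous_foldConfig {N n : ℕ} {X : Type*} [TopologicalSpace X]
    {f g : X → Config N n} (hf : Continuous f) (hg : Continuous g) :
    Continuous fun x => foldConfig (f x) (g x) :=
  continuous_splice _ continuous_const
    (continuous_splice _ hf ((reflectConfig N n).continuous.comp hg))

lemma foldConfig_upper {N n : ℕ} (V V' : Config N n) {b : Bond n} (hb : 0 ≤ b.1 0) :
    foldConfig V V' b = V b := by
  rw [foldConfig, splice_of_notMem _ _ (fun h => by have := h.1; omega)]
  exact splice_of_mem (S := upperBonds n) _ _ hb

lemma foldConfig_crossing {N n : ℕ} (V V' : Config N n) {b : Bond n}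
    (hb : b ∈ crossingBonds n) : foldConfig V V' b = 1 :=
  splice_of_mem _ _ hb

lemma foldConfig_lower {N n : ℕ} (V V' : Config N n) {b : Bond n} (hb : b.1 0 < 0)
    (hc : b ∉ crossingBonds n) : foldConfig V V' b = reflectConfig N n V' b := by
  rw [foldConfig, splice_of_notMem _ _ hc]
  exact splice_of_notMem (S := upperBonds n) _ _ (fun h => by have : 0 ≤ b.1 0 := h; omega)

/-- Passage to temporal gauge on the crossing bonds: a gauge function supported on the time slice
just below the reflection plane turns each crossing bond into `T⁻¹ T = 1` and leaves the upper half
untouched. In the lower half it becomes a gauge transformation of `V'`, which Haar measure does not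
see. -/
lemma gaugeConfig_splice {N n : ℕ} (T V V' : Config N n) :
    let h : Site n → SU N := fun x => if x 0 = -1 then (T (x, 0))⁻¹ else 1
    gaugeConfig h (splice (crossingBonds n) T (splice (upperBonds n) V (reflectConfig N n V'))) =
      foldConfig V (gaugeConfig (fun x => h (timeReflect x)) V') := by
  intro h
  ext1 ⟨x, μ⟩
  by_cases hu : 0 ≤ x 0
  · have h1 : h x = 1 := if_neg (by omega)
    have h2 : h (shift x μ) = 1 := by
      by_cases hμ : μ = 0
      · subst hμ; exact if_neg (by rw [shift_zero_apply_zero]; omega)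
      · exact if_neg (by rw [shift_apply_zero _ hμ]; omega)
    rw [foldConfig_upper _ _ hu]
    simp only [gaugeConfig, h1, h2]
    rw [splice_of_notMem _ _ (fun h => by have : x 0 = -1 := h.1; omega),
      splice_of_mem _ _ (S := upperBonds n) hu]
    simp
  by_cases hc : (x, μ) ∈ crossingBonds n
  · obtain ⟨h1, h2⟩ := hc
    simp only at h1 h2
    subst h2
    rw [foldConfig_crossing _ _ ⟨h1, rfl⟩]
    simp only [gaugeConfig]
    rw [splice_of_mem (S := crossingBonds n) (b := (x, 0)) _ _ ⟨h1, rfl⟩]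
    have h3 : h (shift x 0) = 1 := if_neg (by rw [shift_zero_apply_zero]; omega)
    have h4 : h x = (T (x, 0))⁻¹ := if_pos h1
    rw [h3, h4]
    simp
  · rw [foldConfig_lower _ _ (by simpa using hu) hc, ← gaugeConfig_reflectConfig]
    simp only [gaugeConfig]
    rw [splice_of_notMem _ _ hc, splice_of_notMem (S := upperBonds n) _ _ hu]

/-- For fixed crossing variables `T` the integral over the remaining bonds can be gauged to `T = 1`,
so it does not depend on `T` and averaging over `T` is trivial. -/
lemma integral_foldConfig {N n : ℕ} {E : Type*} [NormedAddCommGroup E] [NormedSpace ℝ E]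
    [CompleteSpace E] {f : Config N n → E} (hf : Continuous f)
    (hg : ∀ (h : Site n → SU N) (U : Config N n), f (gaugeConfig h U) = f U) :
    ∫ U, f U ∂(haarProduct N n) =
      ∫ p : Config N n × Config N n, f (foldConfig p.1 p.2)
        ∂((haarProduct N n).prod (haarProduct N n)) := by
  have hcont : ∀ T : Config N n, Continuous fun U => f (splice (crossingBonds n) T U) :=
    fun T => hf.comp (by fun_prop)
  have hint : Integrable (fun p : Config N n × Config N n => f (foldConfig p.1 p.2))
      ((haarProduct N n).prod (haarProduct N n)) :=
    integrable_of_continuous _ (hf.comp (continuous_foldConfig continuous_fst continuous_snd))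
  rw [integral_prod _ hint, integral_splice (crossingBonds n) hf]
  have key : ∀ T : Config N n,
      ∫ V, f (splice (crossingBonds n) T V) ∂(haarProduct N n) =
        ∫ V, ∫ V', f (foldConfig V V') ∂(haarProduct N n) ∂(haarProduct N n) := by
    intro T
    rw [integral_splice (upperBonds n) (hcont T)]
    congr 1
    ext1 V
    have hc1 : Continuous fun W => f (splice (crossingBonds n) T (splice (upperBonds n) V W)) :=
      (hcont T).comp (by fun_prop)
    -- Reflecting the lower variables on the left, and gauge transforming them by the reflected
    -- gauge function on the right, produces gauge equivalent arguments of `f`.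
    rw [← integral_comp_of_measurePreserving (measurePreserving_reflectConfig N n) hc1]
    have hc2 : Continuous fun W => f (foldConfig V W) := hf.comp (by fun_prop)
    rw [← integral_comp_of_measurePreserving (measurePreserving_gaugeConfig
      (fun x => if timeReflect x 0 = -1 then (T (timeReflect x, 0))⁻¹ else 1)) hc2]
    congr 1
    ext1 V'
    rw [← gaugeConfig_splice T V V', hg]
  simp only [key, integral_const, probReal_univ, one_smul]

/-! ### The Wilson action as a sum over plaquettes -/

/-- The energy `2 Re Tr (1 - U_p)` of the plaquette `p_{μν}(x)`, `q = (x, μ, ν)`. -/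
noncomputable def plaquetteEnergy {N n : ℕ} (U : Config N n)
    (q : Site n × Fin (n + 1) × Fin (n + 1)) : ℝ :=
  2 * (Matrix.trace (1 - (plaquetteVar U q.1 q.2.1 q.2.2).1)).re

/-- The plaquettes in `Λ`. -/
def plaquettes {n : ℕ} (Λ : Finset (Site n)) : Finset (Site n × Fin (n + 1) × Fin (n + 1)) :=
  (Λ ×ˢ Finset.univ ×ˢ Finset.univ).filter fun q =>
    q.2.1 < q.2.2 ∧ shift q.1 q.2.1 ∈ Λ ∧ shift q.1 q.2.2 ∈ Λ ∧ shift (shift q.1 q.2.1) q.2.2 ∈ Λ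

lemma mem_plaquettes {n : ℕ} {Λ : Finset (Site n)} {q : Site n × Fin (n + 1) × Fin (n + 1)} :
    q ∈ plaquettes Λ ↔ q.1 ∈ Λ ∧ q.2.1 < q.2.2 ∧ shift q.1 q.2.1 ∈ Λ ∧ shift q.1 q.2.2 ∈ Λ ∧
      shift (shift q.1 q.2.1) q.2.2 ∈ Λ := by
  simp [plaquettes]

lemma wilsonAction_eq_sum {N n : ℕ} (Λ : Finset (Site n)) (U : Config N n) :
    wilsonAction Λ U = ∑ q ∈ plaquettes Λ, plaquetteEnergy U q := by
  rw [plaquettes, Finset.sum_filter, Finset.sum_product]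
  simp only [Finset.sum_product]
  rfl

lemma continuous_plaquetteVar {N n : ℕ} (x : Site n) (μ ν : Fin (n + 1)) :
    Continuous fun U : Config N n => plaquetteVar U x μ ν := by
  unfold plaquetteVar; fun_prop

lemma continuous_reTrace {N : ℕ} :
    Continuous fun g : SU N => 2 * (Matrix.trace (1 - g.1)).re :=
  continuous_const.mul (Complex.continuous_re.comp
    (Continuous.matrix_trace (continuous_const.sub continuous_subtype_val)))

lemma continuous_plaquetteEnergy {N n : ℕ} (q : Site n × Fin (n + 1) × Fin (n + 1)) :
    Continuous fun U : Config N n => plaquetteEnergy U q :=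
  continuous_reTrace.comp (continuous_plaquetteVar q.1 q.2.1 q.2.2)

lemma continuous_wilsonAction {N n : ℕ} (Λ : Finset (Site n)) :
    Continuous fun U : Config N n => wilsonAction Λ U := by
  simp only [wilsonAction_eq_sum]
  exact continuous_finsetSum _ fun q _ => continuous_plaquetteEnergy q

lemma abs_re_trace_le {N : ℕ} (g : SU N) : |(Matrix.trace g.1).re| ≤ N := by
  refine (Complex.abs_re_le_norm _).trans ?_
  refine (norm_sum_le _ _).trans ?_
  refine (Finset.sum_le_card_nsmul _ _ 1 fun i _ => entry_norm_bound_of_unitary g.2.1 i i).trans ?_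
  simp

lemma reTrace_one_sub {N : ℕ} (g : SU N) :
    2 * (Matrix.trace (1 - g.1)).re = 2 * N - 2 * (Matrix.trace g.1).re := by
  simp [Matrix.trace_sub, mul_sub]

lemma abs_plaquetteEnergy_le {N n : ℕ} (U : Config N n)
    (q : Site n × Fin (n + 1) × Fin (n + 1)) : |plaquetteEnergy U q| ≤ 4 * N := by
  rw [plaquetteEnergy, reTrace_one_sub]
  have := abs_le.mp (abs_re_trace_le (plaquetteVar U q.1 q.2.1 q.2.2))
  rw [abs_le]
  constructor <;> linarith

lemma trace_conj_mul {N : ℕ} (g u : SU N) :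
    Matrix.trace (g * u * g⁻¹).1 = Matrix.trace u.1 := by
  change Matrix.trace (g.1 * u.1 * (g⁻¹ : SU N).1) = _
  rw [Matrix.trace_mul_comm, ← mul_assoc]
  change Matrix.trace ((g⁻¹ * g : SU N).1 * u.1) = _
  rw [inv_mul_cancel]
  simp

lemma trace_inv {N : ℕ} (g : SU N) : Matrix.trace (g⁻¹).1 = conj (Matrix.trace g.1) :=
  Matrix.trace_conjTranspose g.1

lemma trace_conjSU {N : ℕ} (g : SU N) : Matrix.trace (conjSU g).1 = conj (Matrix.trace g.1) := by
  simp [Matrix.trace, conjSU, map_sum]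

lemma plaquetteVar_gaugeConfig {N n : ℕ} (h : Site n → SU N) (U : Config N n) (x : Site n)
    (μ ν : Fin (n + 1)) :
    plaquetteVar (gaugeConfig h U) x μ ν = h x * plaquetteVar U x μ ν * (h x)⁻¹ := by
  simp only [plaquetteVar, gaugeConfig, shift_comm x ν μ]
  group

lemma wilsonAction_gaugeConfig {N n : ℕ} (Λ : Finset (Site n)) (h : Site n → SU N)
    (U : Config N n) : wilsonAction Λ (gaugeConfig h U) = wilsonAction Λ U := by
  simp only [wilsonAction_eq_sum, plaquetteEnergy, reTrace_one_sub, plaquetteVar_gaugeConfig,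
    trace_conj_mul]

lemma plaquetteVar_conjConfig {N n : ℕ} (U : Config N n) (x : Site n) (μ ν : Fin (n + 1)) :
    plaquetteVar (conjConfig N n U) x μ ν = conjSU (plaquetteVar U x μ ν) := by
  simp only [plaquetteVar, conjSU_mul, conjSU_inv]
  rfl

lemma wilsonAction_conjConfig {N n : ℕ} (Λ : Finset (Site n)) (U : Config N n) :
    wilsonAction Λ (conjConfig N n U) = wilsonAction Λ U := by
  simp only [wilsonAction_eq_sum, plaquetteEnergy, reTrace_one_sub, plaquetteVar_conjConfig,
    trace_conjSU, Complex.conj_re]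

/-- The image of a plaquette under time reflection. -/
def reflectPlaquette {n : ℕ} (q : Site n × Fin (n + 1) × Fin (n + 1)) :
    Site n × Fin (n + 1) × Fin (n + 1) :=
  (if q.2.1 = 0 then timeReflect (shift q.1 0) else timeReflect q.1, q.2)

lemma reflectPlaquette_reflectPlaquette {n : ℕ} (q : Site n × Fin (n + 1) × Fin (n + 1)) :
    reflectPlaquette (reflectPlaquette q) = q := by
  obtain ⟨x, μ, ν⟩ := q
  by_cases h : μ = 0
  · simp [reflectPlaquette, h, shift_timeReflect_shift, timeReflect_timeReflect]
  · simp [reflectPlaquette, h, timeReflect_timeReflect]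

/-- Reflection reverses the orientation of a temporal plaquette and moves its base point, so its
variable becomes a conjugate of the inverse; `Re Tr` is insensitive to both. -/
lemma plaquetteEnergy_reflectConfig {N n : ℕ} (U : Config N n)
    {q : Site n × Fin (n + 1) × Fin (n + 1)} (hq : q.2.1 < q.2.2) :
    plaquetteEnergy (reflectConfig N n U) q = plaquetteEnergy U (reflectPlaquette q) := by
  obtain ⟨x, μ, ν⟩ := q
  simp only at hq
  have hν : ν ≠ 0 := fun h => by simp [h] at hq
  simp only [plaquetteEnergy, reTrace_one_sub]
  congr 2
  by_cases hμ : μ = 0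
  · subst hμ
    have h1 : plaquetteVar U (timeReflect (shift x 0)) 0 ν =
        U (timeReflect (shift x 0), 0) * (plaquetteVar (reflectConfig N n U) x 0 ν)⁻¹ *
          (U (timeReflect (shift x 0), 0))⁻¹ := by
      simp [plaquetteVar, reflectConfig_apply, reflectBond, hν, shift_timeReflect_shift,
        timeReflect_shift _ hν, shift_comm _ ν 0, mul_assoc]
    simp only [reflectPlaquette, if_true]
    rw [h1, trace_conj_mul, trace_inv, Complex.conj_re]
  · simp [plaquetteVar, reflectConfig_apply, reflectBond, hν, hμ, reflectPlaquette,
      timeReflect_shift]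

lemma reflectPlaquette_mem {n : ℕ} {Λ : Finset (Site n)} (hΛ : ∀ x ∈ Λ, timeReflect x ∈ Λ)
    {q : Site n × Fin (n + 1) × Fin (n + 1)} (hq : q ∈ plaquettes Λ) :
    reflectPlaquette q ∈ plaquettes Λ := by
  obtain ⟨x, μ, ν⟩ := q
  rw [mem_plaquettes] at hq ⊢
  simp only at hq
  obtain ⟨h1, h2, h3, h4, h5⟩ := hq
  have hν : ν ≠ 0 := fun h => by simp [h] at h2
  by_cases hμ : μ = 0
  · subst hμ
    simp only [reflectPlaquette, if_true, shift_timeReflect_shift, ← timeReflect_shift _ hν]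
    exact ⟨hΛ _ h3, h2, hΛ _ h1, hΛ _ h5, hΛ _ h4⟩
  · simp only [reflectPlaquette, hμ, if_false, ← timeReflect_shift _ hν, ← timeReflect_shift _ hμ]
    exact ⟨hΛ _ h1, h2, hΛ _ h3, hΛ _ h4, hΛ _ h5⟩

/-- The energy of the plaquettes of `Λ` in the half space `x⁰ > 0`. -/
noncomputable def upperAction {N n : ℕ} (Λ : Finset (Site n)) (U : Config N n) : ℝ :=
  ∑ q ∈ (plaquettes Λ).filter (fun q => 0 ≤ q.1 0), plaquetteEnergy U q

lemma continuous_upperAction {N n : ℕ} (Λ : Finset (Site n)) :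
    Continuous fun U : Config N n => upperAction Λ U :=
  continuous_finsetSum _ fun q _ => continuous_plaquetteEnergy q

/-- The bonds in the hyperplane `x⁰ = 1/2` that are edges of plaquettes of `Λ` crossing the
hyperplane `x⁰ = 0`. -/
def couplingBonds {n : ℕ} (Λ : Finset (Site n)) : Finset (Bond n) :=
  ((plaquettes Λ).filter (fun q => q.1 0 = -1 ∧ q.2.1 = 0)).image
    fun q => (shift q.1 0, q.2.2)

lemma plaquetteEnergy_foldConfig_upper {N n : ℕ} (V V' : Config N n)
    {q : Site n × Fin (n + 1) × Fin (n + 1)} (hq : 0 ≤ q.1 0) :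
    plaquetteEnergy (foldConfig V V') q = plaquetteEnergy V q := by
  obtain ⟨x, μ, ν⟩ := q
  simp only at hq
  have hs : ∀ ρ, 0 ≤ shift x ρ 0 := fun ρ => by
    by_cases h : ρ = 0
    · subst h; rw [shift_zero_apply_zero]; omega
    · rwa [shift_apply_zero _ h]
  simp only [plaquetteEnergy, plaquetteVar]
  rw [foldConfig_upper V V' (b := (x, μ)) hq, foldConfig_upper V V' (b := (x, ν)) hq,
    foldConfig_upper V V' (b := (shift x μ, ν)) (hs _),
    foldConfig_upper V V' (b := (shift x ν, μ)) (hs _)]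

lemma plaquetteEnergy_foldConfig_lower {N n : ℕ} (V V' : Config N n)
    {q : Site n × Fin (n + 1) × Fin (n + 1)} (hlt : q.2.1 < q.2.2) (hx : q.1 0 < 0)
    (hc : ¬(q.1 0 = -1 ∧ q.2.1 = 0)) :
    plaquetteEnergy (foldConfig V V') q = plaquetteEnergy V' (reflectPlaquette q) := by
  obtain ⟨x, μ, ν⟩ := q
  simp only at hlt hx hc
  rw [← plaquetteEnergy_reflectConfig _ hlt]
  have hν : ν ≠ 0 := fun h => by simp [h] at hlt
  have hx2 : shift x ν 0 < 0 := by simpa [shift_apply_zero _ hν] using hx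
  have hx1 : shift x μ 0 < 0 := by
    by_cases h : μ = 0
    · subst h
      rw [shift_zero_apply_zero]
      have : x 0 ≠ -1 := fun h => hc ⟨h, rfl⟩
      omega
    · simpa [shift_apply_zero _ h] using hx
  have hc' : (shift x ν, μ) ∉ crossingBonds n := fun h =>
    hc ⟨(shift_apply_zero x hν).symm.trans h.1, h.2⟩
  simp only [plaquetteEnergy, plaquetteVar]
  rw [foldConfig_lower V V' (b := (x, μ)) hx hc,
    foldConfig_lower V V' (b := (x, ν)) hx (fun h => hν h.2),
    foldConfig_lower V V' (b := (shift x μ, ν)) hx1 (fun h => hν h.2),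
    foldConfig_lower V V' (b := (shift x ν, μ)) hx2 hc']

/-- Two edges of a crossing plaquette are crossing bonds and equal `1`; the other two are a bond at
`x⁰ = 1/2` in `V` and its mirror image, read in `V'`. -/
lemma plaquetteEnergy_foldConfig_crossing {N n : ℕ} (V V' : Config N n)
    {q : Site n × Fin (n + 1) × Fin (n + 1)} (hlt : q.2.1 < q.2.2)
    (hc : q.1 0 = -1 ∧ q.2.1 = 0) :
    plaquetteEnergy (foldConfig V V') q = 2 * N - 2 * (Matrix.trace
      (V (shift q.1 0, q.2.2) * (V' (shift q.1 0, q.2.2))⁻¹).1).re := by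
  obtain ⟨x, μ, ν⟩ := q
  obtain ⟨hx, hμ⟩ := hc
  simp only at hlt hx hμ
  subst hμ
  have hν : ν ≠ 0 := hlt.ne'
  simp only [plaquetteEnergy, reTrace_one_sub, plaquetteVar]
  rw [foldConfig_crossing V V' (b := (x, 0)) ⟨hx, rfl⟩,
    foldConfig_crossing V V' (b := (shift x ν, 0)) ⟨(shift_apply_zero x hν).trans hx, rfl⟩,
    foldConfig_upper V V' (b := (shift x 0, ν)) (by simp [shift_zero_apply_zero, hx]),
    foldConfig_lower V V' (b := (x, ν)) (by simp [hx]) (fun h => hν h.2)]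
  simp [reflectConfig_apply, hν, reflectBond, timeReflect_eq_shift hx]

lemma sum_crossing_foldConfig {N n : ℕ} (Λ : Finset (Site n)) (V V' : Config N n) :
    ∑ q ∈ (plaquettes Λ).filter (fun q => q.1 0 = -1 ∧ q.2.1 = 0),
      plaquetteEnergy (foldConfig V V') q =
    ∑ b ∈ couplingBonds Λ, (2 * N - 2 * (Matrix.trace (V b * (V' b)⁻¹).1).re) := by
  rw [couplingBonds, Finset.sum_image]
  · refine Finset.sum_congr rfl fun q hq => ?_
    rw [Finset.mem_filter, mem_plaquettes] at hq
    exact plaquetteEnergy_foldConfig_crossing V V' hq.1.2.1 hq.2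
  · rintro ⟨x, μ, ν⟩ hq ⟨x', μ', ν'⟩ hq' heq
    simp only [Finset.coe_filter, Set.mem_ofPred_eq, Prod.mk.injEq] at hq hq' heq
    have : x = x' := add_right_cancel heq.1
    simp [this, heq.2, hq.2.2, hq'.2.2]

lemma sum_lower_foldConfig {N n : ℕ} {Λ : Finset (Site n)}
    (hΛ : ∀ x ∈ Λ, timeReflect x ∈ Λ) (V V' : Config N n) :
    ∑ q ∈ (plaquettes Λ).filter (fun q => q.1 0 < 0 ∧ ¬(q.1 0 = -1 ∧ q.2.1 = 0)),
      plaquetteEnergy (foldConfig V V') q = upperAction Λ V' := by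
  -- A temporal plaquette is based at its lower end, which is the mirror image of the original upper
  -- end; hence `-2` instead of `-1`.
  have hz : ∀ q : Site n × Fin (n + 1) × Fin (n + 1), (reflectPlaquette q).1 0 =
      if q.2.1 = 0 then -2 - q.1 0 else -1 - q.1 0 := by
    intro q
    by_cases hμ : q.2.1 = 0
    · simp only [reflectPlaquette, hμ, if_true, timeReflect_apply_zero, shift_zero_apply_zero]
      ring
    · simp only [reflectPlaquette, hμ, if_false, timeReflect_apply_zero]
  refine Finset.sum_nbij' reflectPlaquette reflectPlaquette ?_ ?_
    (fun q _ => reflectPlaquette_reflectPlaquette q)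
    (fun q _ => reflectPlaquette_reflectPlaquette q) ?_
  · intro q hq
    rw [Finset.mem_filter] at hq ⊢
    refine ⟨reflectPlaquette_mem hΛ hq.1, ?_⟩
    rw [hz]
    split_ifs with hμ
    · have : q.1 0 ≠ -1 := fun h => hq.2.2 ⟨h, hμ⟩
      have := hq.2.1
      omega
    · have := hq.2.1
      omega
  · intro q hq
    rw [Finset.mem_filter] at hq ⊢
    have h2 : (reflectPlaquette q).2.1 = q.2.1 := rfl
    refine ⟨reflectPlaquette_mem hΛ hq.1, ?_⟩
    have h0 := hq.2
    rw [hz, h2]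
    split_ifs with hμ
    · exact ⟨by omega, fun h => by have := h.1; omega⟩
    · exact ⟨by omega, fun h => hμ h.2⟩
  · intro q hq
    rw [Finset.mem_filter, mem_plaquettes] at hq
    exact plaquetteEnergy_foldConfig_lower V V' hq.1.2.1 hq.2.1 hq.2.2

/-- Plaquettes lie above the reflection plane, below it, or across it. Reflection matches the first
two kinds, so only the third couples `V` and `V'`. -/
lemma wilsonAction_foldConfig {N n : ℕ} {Λ : Finset (Site n)}
    (hΛ : ∀ x ∈ Λ, timeReflect x ∈ Λ) (V V' : Config N n) :
    wilsonAction Λ (foldConfig V V') = upperAction Λ V + upperAction Λ V' +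
      ∑ b ∈ couplingBonds Λ, (2 * N - 2 * (Matrix.trace (V b * (V' b)⁻¹).1).re) := by
  rw [wilsonAction_eq_sum, ← sum_lower_foldConfig hΛ V V', ← sum_crossing_foldConfig,
    ← Finset.sum_filter_add_sum_filter_not _ (fun q => 0 ≤ q.1 0),
    ← Finset.sum_filter_add_sum_filter_not ((plaquettes Λ).filter (fun q => ¬ 0 ≤ q.1 0))
      (fun q => q.1 0 = -1 ∧ q.2.1 = 0), Finset.filter_filter, Finset.filter_filter, add_assoc]
  simp only [not_le]
  have h1 : ∀ q : Site n × Fin (n + 1) × Fin (n + 1),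
      (q.1 0 < 0 ∧ (q.1 0 = -1 ∧ q.2.1 = 0)) ↔ (q.1 0 = -1 ∧ q.2.1 = 0) :=
    fun q => ⟨fun h => h.2, fun h => ⟨by omega, h⟩⟩
  simp only [h1]
  have h2 : ∑ q ∈ (plaquettes Λ).filter (fun q => 0 ≤ q.1 0),
      plaquetteEnergy (foldConfig V V') q = upperAction Λ V :=
    Finset.sum_congr rfl fun q hq =>
      plaquetteEnergy_foldConfig_upper V V' (Finset.mem_filter.mp hq).2
  rw [h2, add_comm (Finset.sum _ _) (Finset.sum _ _)]

/-- Each bond at `x⁰ = 1/2` is an edge of the crossing plaquette based one time step below it, so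
large volumes contain the whole coupling on `S`. -/
lemma exists_subset_couplingBonds {n : ℕ} (S : Finset (Bond n)) (hS : ↑S ⊆ halfBonds n) :
    ∃ s : Finset (Site n), ∀ Λ : Finset (Site n), s ⊆ Λ → S ⊆ couplingBonds Λ := by
  classical
  refine ⟨S.biUnion fun b => {b.1 - Pi.single 0 1, b.1, shift (b.1 - Pi.single 0 1) b.2,
    shift b.1 b.2}, fun Λ hΛ b hb => ?_⟩
  have hsub := fun x hx => hΛ (Finset.mem_biUnion.mpr ⟨b, hb, hx⟩ : x ∈ _)
  have hb' := hS hb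
  have h0 : shift (b.1 - Pi.single 0 1) 0 = b.1 := by simp [shift]
  refine Finset.mem_image.mpr ⟨(b.1 - Pi.single 0 1, 0, b.2), ?_, by rw [h0]⟩
  rw [Finset.mem_filter, mem_plaquettes]
  refine ⟨⟨hsub _ (by simp), Fin.pos_iff_ne_zero.mpr hb'.2, ?_, hsub _ (by simp), ?_⟩, ?_, rfl⟩
  · rw [h0]; exact hsub _ (by simp)
  · rw [h0]; exact hsub _ (by simp)
  · simp [hb'.1]

/-! ### Positive definite kernels -/

section Kernel

open scoped ComplexOrder

set_option linter.unusedSectionVars false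

variable {X : Type*} [TopologicalSpace X]

/-- The kernel `u ⊗ u^*`. -/
noncomputable def tensor (u : C(X, ℂ)) : C(X × X, ℂ) where
  toFun p := u p.1 * conj (u p.2)
  continuous_toFun := by
    have := Complex.continuous_conj
    fun_prop

lemma tensor_apply (u : C(X, ℂ)) (p : X × X) : tensor u p = u p.1 * conj (u p.2) := rfl

lemma tensor_mul (u v : C(X, ℂ)) : tensor (u * v) = tensor u * tensor v := by
  ext p; simp only [tensor_apply, ContinuousMap.mul_apply, map_mul]; ring

lemma tensor_algebraMap (c : ℂ) :
    tensor (algebraMap ℂ C(X, ℂ) c) = algebraMap ℂ C(X × X, ℂ) ((Complex.normSq c : ℝ) : ℂ) := by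
  ext p
  simp [tensor_apply, Complex.mul_conj]

/-- The parallelogram identity. Discarding the positive kernel of `u - v` bounds that of `u + v` by
twice the sum. -/
lemma tensor_add_add_tensor_sub (u v : C(X, ℂ)) :
    tensor (u + v) + tensor (u - v) = (tensor u + tensor u) + (tensor v + tensor v) := by
  ext p
  simp only [tensor_apply, ContinuousMap.add_apply, ContinuousMap.sub_apply, map_add, map_sub]
  ring

variable [CompactSpace X] [MeasurableSpace X] [BorelSpace X] [SecondCountableTopology X]
  (μ : Measure X) [IsProbabilityMeasure μ]

/-- The quadratic form `∫∫ φ(x) φ(y)^* K(x, y)` of the kernel `K`. -/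
noncomputable def kernelForm (φ : C(X, ℂ)) (K : C(X × X, ℂ)) : ℂ :=
  ∫ p, tensor φ p * K p ∂(μ.prod μ)

lemma kernelForm_add (φ : C(X, ℂ)) (K L : C(X × X, ℂ)) :
    kernelForm μ φ (K + L) = kernelForm μ φ K + kernelForm μ φ L := by
  unfold kernelForm
  rw [← integral_add (integrable_of_continuous _ (by fun_prop))
    (integrable_of_continuous _ (by fun_prop))]
  simp [mul_add]

lemma kernelForm_smul (φ : C(X, ℂ)) (c : ℂ) (K : C(X × X, ℂ)) :
    kernelForm μ φ (c • K) = c * kernelForm μ φ K := by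
  unfold kernelForm
  rw [← integral_const_mul]
  simp [mul_left_comm]

lemma kernelForm_sub (φ : C(X, ℂ)) (K L : C(X × X, ℂ)) :
    kernelForm μ φ (K - L) = kernelForm μ φ K - kernelForm μ φ L := by
  rw [eq_sub_iff_add_eq, ← kernelForm_add, sub_add_cancel]

/-- A rank-one factor can be absorbed into the test function; this is the whole content of the Schur
product theorem needed here. -/
lemma kernelForm_mul_tensor (φ u : C(X, ℂ)) (K : C(X × X, ℂ)) :
    kernelForm μ φ (K * tensor u) = kernelForm μ (φ * u) K := by
  simp only [kernelForm, tensor_mul, ContinuousMap.mul_apply]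
  congr 1; ext p; ring

lemma continuous_kernelForm (φ : C(X, ℂ)) : Continuous (kernelForm μ φ) := by
  let f : C(X × X, ℂ) →+ ℂ :=
    { toFun := kernelForm μ φ
      map_zero' := by simp [kernelForm]
      map_add' := kernelForm_add μ φ }
  refine AddMonoidHomClass.continuous_of_bound f ‖tensor φ‖ fun K => ?_
  change ‖∫ p, tensor φ p * K p ∂(μ.prod μ)‖ ≤ _
  refine (norm_integral_le_of_norm_le_const (C := ‖tensor φ‖ * ‖K‖)
    (.of_forall fun p => ?_)).trans ?_
  · rw [norm_mul]
    exact mul_le_mul ((tensor φ).norm_coe_le_norm p) (K.norm_coe_le_norm p) (norm_nonneg _)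
      (norm_nonneg _)
  · simp

/-- Positive definite kernels. -/
def IsPosKernel (K : C(X × X, ℂ)) : Prop := ∀ φ : C(X, ℂ), 0 ≤ kernelForm μ φ K

lemma isPosKernel_one : IsPosKernel μ (1 : C(X × X, ℂ)) := by
  intro φ
  simp only [kernelForm, ContinuousMap.one_apply, mul_one, tensor_apply]
  rw [integral_prod_mul (fun x => φ x) (fun x => conj (φ x)), integral_conj, Complex.mul_conj]
  exact_mod_cast Complex.normSq_nonneg _

/-- The kernels multiplication by which preserves positive definiteness. -/
def posKernels : Subsemiring C(X × X, ℂ) where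
  carrier := {L | ∀ K, IsPosKernel μ K → IsPosKernel μ (K * L)}
  mul_mem' ha hb K hK := by rw [← mul_assoc]; exact hb _ (ha K hK)
  one_mem' K hK := by rwa [mul_one]
  add_mem' ha hb K hK φ := by
    rw [mul_add, kernelForm_add]; exact add_nonneg (ha K hK φ) (hb K hK φ)
  zero_mem' K hK φ := by simp [kernelForm]

/-- Multipliers of positive definite kernels are themselves positive definite because the constant
kernel `1` is. Working with multipliers makes closure under products automatic. -/
lemma isPosKernel_of_mem {L : C(X × X, ℂ)} (hL : L ∈ posKernels μ) : IsPosKernel μ L := by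
  simpa using hL 1 (isPosKernel_one μ)

lemma tensor_mem (u : C(X, ℂ)) : tensor u ∈ posKernels μ := fun K hK φ => by
  rw [kernelForm_mul_tensor]; exact hK _

/-- Sup-norm closedness is what lets the exponential series converge inside the cone. -/
lemma isClosed_posKernels : IsClosed (posKernels μ : Set C(X × X, ℂ)) := by
  have : (posKernels μ : Set C(X × X, ℂ)) =
      ⋂ (K) (_ : IsPosKernel μ K) (φ), {L | 0 ≤ kernelForm μ φ (K * L)} := by
    ext L; simp only [Set.mem_iInter]; rfl
  rw [this]
  refine isClosed_iInter fun K => isClosed_iInter fun _ => isClosed_iInter fun φ => ?_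
  exact isClosed_le continuous_const
    ((continuous_kernelForm μ φ).comp (continuous_const.mul continuous_id))

lemma algebraMap_mem_posKernels {c : ℝ} (hc : 0 ≤ c) :
    algebraMap ℂ C(X × X, ℂ) c ∈ posKernels μ := by
  have := tensor_mem μ (algebraMap ℂ C(X, ℂ) (Real.sqrt c : ℝ))
  rwa [tensor_algebraMap, Complex.normSq_ofReal, Real.mul_self_sqrt hc] at this

lemma smul_mem_posKernels {c : ℝ} (hc : 0 ≤ c) {L : C(X × X, ℂ)} (hL : L ∈ posKernels μ) :
    (c : ℂ) • L ∈ posKernels μ := by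
  rw [Algebra.smul_def]
  exact mul_mem (algebraMap_mem_posKernels μ hc) hL

/-! ### Exponentials of positive kernels and the functions they dominate -/

lemma exp_apply (L : C(X × X, ℂ)) (p : X × X) : NormedSpace.exp L p = Complex.exp (L p) := by
  have := NormedSpace.map_exp (ContinuousMap.evalAlgHom ℂ ℂ p)
    (ContinuousEvalConst.continuous_eval_const p) L
  rw [Complex.exp_eq_exp_ℂ]
  exact this

/-- The exponential series without its first two terms still has nonnegative coefficients. Adding
terms back gives the lower bounds `L`, `1` and `0` for `exp L` in the kernel order. -/
lemma exp_sub_mem_posKernels {L : C(X × X, ℂ)} (hL : L ∈ posKernels μ) :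
    NormedSpace.exp L - 1 - L ∈ posKernels μ := by
  have h := NormedSpace.exp_series_hasSum_exp' (𝕂 := ℂ) L
  have h2 := (hasSum_nat_add_iff' 2).mpr h
  simp only [Finset.sum_range_succ, Finset.sum_range_zero] at h2
  have h3 : NormedSpace.exp L - 1 - L ∈ closure (posKernels μ : Set C(X × X, ℂ)) := by
    have h4 : NormedSpace.exp L - 1 - L = NormedSpace.exp L -
      (0 + ((Nat.factorial 0 : ℂ)⁻¹ • L ^ 0) + ((Nat.factorial 1 : ℂ)⁻¹ • L ^ 1)) := by
      simp [sub_sub]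
    rw [h4]
    refine mem_closure_of_tendsto h2 (.of_forall fun s => ?_)
    refine sum_mem fun i _ => ?_
    have := smul_mem_posKernels μ (c := ((i + 2).factorial : ℝ)⁻¹) (by positivity)
      (pow_mem hL (i + 2))
    simpa using this
  rwa [(isClosed_posKernels μ).closure_eq] at h3

lemma exp_sub_self_mem_posKernels {L : C(X × X, ℂ)} (hL : L ∈ posKernels μ) :
    NormedSpace.exp L - L ∈ posKernels μ := by
  have := add_mem (exp_sub_mem_posKernels μ hL) (one_mem _)
  rwa [sub_right_comm, sub_add_cancel] at this

lemma exp_sub_one_mem_posKernels {L : C(X × X, ℂ)} (hL : L ∈ posKernels μ) :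
    NormedSpace.exp L - 1 ∈ posKernels μ := by
  have := add_mem (exp_sub_mem_posKernels μ hL) hL
  rwa [sub_add_cancel] at this

lemma exp_mem_posKernels {L : C(X × X, ℂ)} (hL : L ∈ posKernels μ) :
    NormedSpace.exp L ∈ posKernels μ := by
  have := add_mem (exp_sub_one_mem_posKernels μ hL) (one_mem _)
  rwa [sub_add_cancel] at this

/-- The functions `w` such that `w ⊗ w^*` is dominated by multiples of `exp (ε L)`, for
all `ε > 0`. -/
noncomputable def dominated {L : C(X × X, ℂ)} (hL : L ∈ posKernels μ) : Subalgebra ℂ C(X, ℂ) where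
  carrier := {w | ∀ ε : ℝ, 0 < ε → ∃ c : ℝ, 0 ≤ c ∧
    (c : ℂ) • NormedSpace.exp ((ε : ℂ) • L) - tensor w ∈ posKernels μ}
  mul_mem' {u v} hu hv ε hε := by
    obtain ⟨c, hc, hcu⟩ := hu (ε / 2) (half_pos hε)
    obtain ⟨d, hd, hdv⟩ := hv (ε / 2) (half_pos hε)
    -- Halving `ε` makes the class multiplicative, since `exp (ε/2 L)² = exp (ε L)`; this is why
    -- domination is required for every `ε > 0`.
    refine ⟨c * d, mul_nonneg hc hd, ?_⟩
    set E := NormedSpace.exp (((ε / 2 : ℝ) : ℂ) • L) with hE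
    have hEm : E ∈ posKernels μ :=
      exp_mem_posKernels μ (smul_mem_posKernels μ (half_pos hε).le hL)
    have h1 : NormedSpace.exp ((ε : ℂ) • L) = E * E := by
      rw [hE, ← NormedSpace.exp_add, ← add_smul]
      congr 2
      push_cast
      ring
    -- The difference of the two products telescopes into products of positive kernels.
    have h2 : ((c * d : ℝ) : ℂ) • (E * E) - tensor (u * v) =
        ((c : ℂ) • E - tensor u) * ((d : ℂ) • E) + tensor u * ((d : ℂ) • E - tensor v) := by
      rw [tensor_mul, Complex.ofReal_mul, ← smul_mul_smul_comm]
      ring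
    rw [h1, h2]
    exact add_mem (mul_mem hcu (smul_mem_posKernels μ hd hEm)) (mul_mem (tensor_mem μ u) hdv)
  add_mem' {u v} hu hv ε hε := by
    obtain ⟨c, hc, hcu⟩ := hu ε hε
    obtain ⟨d, hd, hdv⟩ := hv ε hε
    -- The factor `2` comes from the parallelogram identity.
    refine ⟨2 * (c + d), by positivity, ?_⟩
    have h := tensor_add_add_tensor_sub u v
    set E := NormedSpace.exp ((ε : ℂ) • L) with hE
    have h2 : ((2 * (c + d) : ℝ) : ℂ) • E - tensor (u + v) =
        (((c : ℂ) • E - tensor u) + ((c : ℂ) • E - tensor u)) +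
        (((d : ℂ) • E - tensor v) + ((d : ℂ) • E - tensor v)) + tensor (u - v) := by
      rw [eq_sub_of_add_eq h]
      push_cast
      module
    rw [h2]
    exact add_mem (add_mem (add_mem hcu hcu) (add_mem hdv hdv)) (tensor_mem μ _)
  algebraMap_mem' a ε hε := by
    refine ⟨Complex.normSq a, Complex.normSq_nonneg a, ?_⟩
    rw [tensor_algebraMap, Algebra.algebraMap_eq_smul_one, ← smul_sub]
    exact smul_mem_posKernels μ (Complex.normSq_nonneg a)
      (exp_sub_one_mem_posKernels μ (smul_mem_posKernels μ hε.le hL))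

/-- In the kernel order `exp (ε L) ≥ ε L ≥ ε u ⊗ u^*`, whence the constant `ε⁻¹`. -/
lemma mem_dominated_of_sub_mem {L : C(X × X, ℂ)} (hL : L ∈ posKernels μ) {u : C(X, ℂ)}
    (hu : L - tensor u ∈ posKernels μ) : u ∈ dominated μ hL := by
  intro ε hε
  refine ⟨ε⁻¹, by positivity, ?_⟩
  have h1 := exp_sub_self_mem_posKernels μ (smul_mem_posKernels μ hε.le hL)
  have h2 := smul_mem_posKernels μ (c := ε⁻¹) (by positivity) h1
  have h3 := add_mem h2 hu
  rwa [smul_sub, smul_smul, ← Complex.ofReal_mul, inv_mul_cancel₀ hε.ne', Complex.ofReal_one,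
    one_smul, sub_add_sub_cancel] at h3

end Kernel

/-! ### The kernel coupling the two half spaces -/

/-- The kernel `2 Re Tr (V_b V'_b^†)`. -/
noncomputable def bondKernel (N : ℕ) {n : ℕ} (b : Bond n) :
    C(Config N n × Config N n, ℂ) :=
  ∑ i : Fin N, ∑ j : Fin N, (tensor (matrixElement b i j) + tensor (matrixElementConj b i j))

/-- `Tr (V V'^†) = ∑ V_ij (V'_ij)^*` is a sum of rank-one kernels, and the conjugate matrix elements
supply its complex conjugate. This is the source of reflection positivity for the Wilson action. -/
lemma bondKernel_apply {N n : ℕ} (b : Bond n) (p : Config N n × Config N n) :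
    bondKernel N b p = ((2 * (Matrix.trace (p.1 b * (p.2 b)⁻¹).1).re : ℝ) : ℂ) := by
  have h : Matrix.trace (p.1 b * (p.2 b)⁻¹).1 = ∑ i, ∑ j, (p.1 b).1 i j * conj ((p.2 b).1 i j) := by
    change Matrix.trace ((p.1 b).1 * star (p.2 b).1) = _
    simp only [Matrix.trace, Matrix.diag, Matrix.mul_apply]
    rfl
  have h2 : ((2 * (Matrix.trace (p.1 b * (p.2 b)⁻¹).1).re : ℝ) : ℂ) =
      Matrix.trace (p.1 b * (p.2 b)⁻¹).1 + conj (Matrix.trace (p.1 b * (p.2 b)⁻¹).1) := by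
    rw [Complex.add_conj]
  rw [h2, h]
  simp only [bondKernel, ContinuousMap.coe_sum, Finset.sum_apply, ContinuousMap.add_apply,
    map_sum, ← Finset.sum_add_distrib, map_mul]
  rfl

lemma bondKernel_mem {N n : ℕ} (b : Bond n) : bondKernel N b ∈ posKernels (haarProduct N n) :=
  sum_mem fun _ _ => sum_mem fun _ _ => add_mem (tensor_mem _ _) (tensor_mem _ _)

lemma sum_bondKernel_mem {N n : ℕ} (S : Finset (Bond n)) :
    ∑ b ∈ S, bondKernel N b ∈ posKernels (haarProduct N n) :=
  sum_mem fun b _ => bondKernel_mem b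

/-- In the order defined by `P`, a sum of nonnegative terms dominates whatever one of its terms
dominates. -/
lemma sum_sub_mem_of_mem {ι A : Type*} [Ring A] (P : Subsemiring A) {s : Finset ι} {f : ι → A}
    (hf : ∀ i ∈ s, f i ∈ P) {i : ι} (hi : i ∈ s) {a : A} (ha : f i - a ∈ P) :
    ∑ i ∈ s, f i - a ∈ P := by
  classical
  rw [← Finset.add_sum_erase s f hi, add_sub_right_comm]
  exact add_mem ha (sum_mem fun j hj => hf j (Finset.mem_of_mem_erase hj))

/-- The polynomials in the matrix elements of the bond variables of the bonds in `S` and of their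
inverses. -/
noncomputable def bondPolynomials (N : ℕ) {n : ℕ} (S : Set (Bond n)) : Subalgebra ℂ C(Config N n, ℂ) :=
  Algebra.adjoin ℂ {F | ∃ b ∈ S, ∃ i j : Fin N,
    F = matrixElement b i j ∨ F = matrixElementConj b i j}

/-- The dominated functions form an algebra, so generators suffice; the rank-one kernel of a
generator is one of the summands of its bond kernel. -/
lemma bondPolynomials_le_dominated (N : ℕ) {n : ℕ} (S : Finset (Bond n)) :
    bondPolynomials N (S : Set (Bond n)) ≤
      dominated (haarProduct N n) (sum_bondKernel_mem S) := by
  refine Algebra.adjoin_le ?_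
  rintro F ⟨b, hb, i, j, hF⟩
  refine mem_dominated_of_sub_mem _ _ ?_
  refine sum_sub_mem_of_mem _ (fun c _ => bondKernel_mem c) hb ?_
  refine sum_sub_mem_of_mem _ (fun k _ => sum_mem fun l _ => add_mem (tensor_mem _ _)
    (tensor_mem _ _)) (Finset.mem_univ i) ?_
  refine sum_sub_mem_of_mem _ (fun k _ => add_mem (tensor_mem _ _)
    (tensor_mem _ _)) (Finset.mem_univ j) ?_
  rcases hF with rfl | rfl
  · rw [add_sub_cancel_left]; exact tensor_mem _ _
  · rw [add_sub_cancel_right]; exact tensor_mem _ _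

/-! ### Reflection positivity in finite volume -/

section ReflectionPositivity

open scoped ComplexOrder

lemma bondPolynomials_congr {N n : ℕ} {S : Set (Bond n)} {F : C(Config N n, ℂ)}
    (hF : F ∈ bondPolynomials N S) {U V : Config N n} (h : ∀ b ∈ S, U b = V b) : F U = F V := by
  induction hF using Algebra.adjoin_induction with
  | mem F hF =>
    obtain ⟨b, hb, i, j, rfl | rfl⟩ := hF
    · change (U b).1 i j = (V b).1 i j
      rw [h b hb]
    · change star ((U b).1 i j) = star ((V b).1 i j)
      rw [h b hb]
  | algebraMap c => rfl
  | add F G _ _ hF hG => rw [ContinuousMap.add_apply, ContinuousMap.add_apply, hF, hG]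
  | mul F G _ _ hF hG => rw [ContinuousMap.mul_apply, ContinuousMap.mul_apply, hF, hG]

/-- The function `F ΘF`. -/
noncomputable def osFun {N n : ℕ} (F : C(Config N n, ℂ)) : C(Config N n, ℂ) :=
  F * star (F.comp (reflectConfig N n))

lemma osFun_apply {N n : ℕ} (F : C(Config N n, ℂ)) (U : Config N n) :
    osFun F U = F U * conj (F (reflectConfig N n U)) := rfl

lemma osFun_gaugeConfig {N n : ℕ} {F : C(Config N n, ℂ)} (hF : F ∈ observables N n)
    (h : Site n → SU N) (U : Config N n) : osFun F (gaugeConfig h U) = osFun F U := by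
  have h1 := gaugeConfig_reflectConfig (fun x => h (timeReflect x)) U
  simp only [timeReflect_timeReflect] at h1
  rw [osFun_apply, osFun_apply, hF.2 h U, ← h1, hF.2 _ (reflectConfig N n U)]

/-- `F` only sees bonds at `x⁰ = 1/2`, which are read in `V`; after reflection the same bonds are
read in `V'`. -/
lemma osFun_foldConfig {N n : ℕ} {F : C(Config N n, ℂ)} (hF : F ∈ observables N n)
    (V V' : Config N n) : osFun F (foldConfig V V') = tensor F (V, V') := by
  have hF1 : F ∈ bondPolynomials N (halfBonds n) := hF.1
  rw [osFun_apply, tensor_apply]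
  congr 1
  · exact bondPolynomials_congr hF1 fun b hb => foldConfig_upper V V' hb.1.ge
  · congr 1
    refine bondPolynomials_congr hF1 fun b hb => ?_
    have h1 : reflectBond b = (timeReflect b.1, b.2) := by simp [reflectBond, hb.2]
    rw [reflectConfig_apply, if_neg hb.2, foldConfig_lower V V' _ (fun h => hb.2 ?_),
      reflectConfig_apply, if_neg (by rw [h1]; exact hb.2), reflectBond_reflectBond]
    · simp [h1, timeReflect_apply_zero, hb.1]
    · have := h.2
      rwa [h1] at this

/-- The Boltzmann factor of the upper half space. -/
noncomputable def upperWeight (N : ℕ) {n : ℕ} (β : ℝ) (Λ : Finset (Site n)) :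
    C(Config N n, ℂ) where
  toFun U := (Real.exp (-β * upperAction Λ U) : ℝ)
  continuous_toFun := Complex.continuous_ofReal.comp
    (Real.continuous_exp.comp (continuous_const.mul (continuous_upperAction Λ)))

/-- The kernel coupling the half spaces. -/
noncomputable def couplingKernel (N : ℕ) {n : ℕ} (β : ℝ) (S : Finset (Bond n)) :
    C(Config N n × Config N n, ℂ) :=
  NormedSpace.exp ((β : ℂ) • ∑ b ∈ S, bondKernel N b)

lemma couplingKernel_apply {N n : ℕ} (β : ℝ) (S : Finset (Bond n))
    (p : Config N n × Config N n) :
    couplingKernel N β S p =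
      (Real.exp (β * ∑ b ∈ S, 2 * (Matrix.trace (p.1 b * (p.2 b)⁻¹).1).re) : ℝ) := by
  rw [couplingKernel, exp_apply]
  simp only [ContinuousMap.smul_apply, ContinuousMap.coe_sum, Finset.sum_apply,
    bondKernel_apply, smul_eq_mul]
  push_cast
  rfl

lemma couplingKernel_mem {N n : ℕ} {β : ℝ} (hβ : 0 ≤ β) (S : Finset (Bond n)) :
    couplingKernel N β S ∈ posKernels (haarProduct N n) :=
  exp_mem_posKernels _ (smul_mem_posKernels _ hβ (sum_bondKernel_mem S))

/-- Each half-space Boltzmann factor joins `F` in the test function, the crossing plaquettes give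
the kernel, and their constant energies `2N` give the prefactor. -/
lemma integral_osFun {N n : ℕ} (β : ℝ) {F : C(Config N n, ℂ)} (hF : F ∈ observables N n)
    {Λ : Finset (Site n)} (hΛ : ∀ x ∈ Λ, timeReflect x ∈ Λ) :
    ∫ U, osFun F U * (Real.exp (-β * wilsonAction Λ U) : ℂ) ∂(haarProduct N n) =
      (Real.exp (-β * ((couplingBonds Λ).card * (2 * N))) : ℝ) *
        kernelForm (haarProduct N n) (F * upperWeight N β Λ)
          (couplingKernel N β (couplingBonds Λ)) := by
  have hc : Continuous fun U : Config N n =>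
      osFun F U * (Real.exp (-β * wilsonAction Λ U) : ℂ) :=
    (osFun F).continuous.mul (Complex.continuous_ofReal.comp
      (Real.continuous_exp.comp (continuous_const.mul (continuous_wilsonAction Λ))))
  rw [integral_foldConfig hc fun h U => by
    rw [osFun_gaugeConfig hF, wilsonAction_gaugeConfig]]
  rw [kernelForm, ← integral_const_mul]
  congr 1
  ext1 p
  have h1 : Real.exp (-β * wilsonAction Λ (foldConfig p.1 p.2)) =
      Real.exp (-β * ((couplingBonds Λ).card * (2 * N))) * (Real.exp (-β * upperAction Λ p.1) *
        Real.exp (-β * upperAction Λ p.2) *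
        Real.exp (β * ∑ b ∈ couplingBonds Λ, 2 * (Matrix.trace (p.1 b * (p.2 b)⁻¹).1).re)) := by
    rw [wilsonAction_foldConfig hΛ, Finset.sum_sub_distrib, Finset.sum_const, nsmul_eq_mul,
      ← Real.exp_add, ← Real.exp_add, ← Real.exp_add]
    congr 1
    ring
  rw [osFun_foldConfig hF, h1, couplingKernel_apply]
  have h2 : tensor (upperWeight N β Λ) p =
      (Real.exp (-β * upperAction Λ p.1) * Real.exp (-β * upperAction Λ p.2) : ℝ) := by
    rw [tensor_apply, Complex.ofReal_mul]
    congr 1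
    exact Complex.conj_ofReal _
  rw [tensor_mul, ContinuousMap.mul_apply, h2]
  push_cast
  ring

lemma integrable_exp_neg_wilsonAction {N n : ℕ} (β : ℝ) (Λ : Finset (Site n)) :
    Integrable (fun U : Config N n => Real.exp (-β * wilsonAction Λ U)) (haarProduct N n) :=
  integrable_of_continuous _
    (Real.continuous_exp.comp (continuous_const.mul (continuous_wilsonAction Λ)))

lemma partitionFunction_pos (N : ℕ) {n : ℕ} (β : ℝ) (Λ : Finset (Site n)) :
    0 < partitionFunction N β Λ :=
  integral_exp_pos (integrable_exp_neg_wilsonAction β Λ)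

/-- The factor relating correlations to the quadratic form of the coupling kernel. -/
noncomputable def osFactor (N : ℕ) {n : ℕ} (β : ℝ) (Λ : Finset (Site n)) : ℝ :=
  (partitionFunction N β Λ)⁻¹ * Real.exp (-β * ((couplingBonds Λ).card * (2 * N)))

lemma osFactor_nonneg (N : ℕ) {n : ℕ} (β : ℝ) (Λ : Finset (Site n)) : 0 ≤ osFactor N β Λ :=
  mul_nonneg (inv_nonneg.mpr (partitionFunction_pos N β Λ).le) (Real.exp_nonneg _)

lemma correlation_osFun {N n : ℕ} (β : ℝ) {F : C(Config N n, ℂ)} (hF : F ∈ observables N n)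
    {Λ : Finset (Site n)} (hΛ : ∀ x ∈ Λ, timeReflect x ∈ Λ) :
    correlation β Λ (osFun F) = (osFactor N β Λ : ℝ) *
      kernelForm (haarProduct N n) (F * upperWeight N β Λ)
        (couplingKernel N β (couplingBonds Λ)) := by
  rw [correlation, integral_osFun β hF hΛ, osFactor]
  push_cast
  ring

lemma correlation_osFun_nonneg {N n : ℕ} {β : ℝ} (hβ : 0 ≤ β) {F : C(Config N n, ℂ)}
    (hF : F ∈ observables N n) {Λ : Finset (Site n)} (hΛ : ∀ x ∈ Λ, timeReflect x ∈ Λ) :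
    0 ≤ correlation β Λ (osFun F) := by
  rw [correlation_osFun β hF hΛ]
  exact mul_nonneg (by exact_mod_cast osFactor_nonneg N β Λ)
    (isPosKernel_of_mem _ (couplingKernel_mem hβ _) _)

lemma isReflectionPositive_of_isThermodynamicLimit {N n : ℕ} {β : ℝ} (hβ : 0 ≤ β)
    {m : ProbabilityMeasure (Config N n)} (hm : IsThermodynamicLimit β m) :
    IsReflectionPositive m := by
  obtain ⟨l, hl, -, h⟩ := hm
  intro F hF
  have h1 : 0 ≤ osForm m F F :=
    ge_of_tendsto (h (osFun F)) (.of_forall fun Λ => correlation_osFun_nonneg hβ hF Λ.2)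
  rw [Complex.le_def] at h1
  exact ⟨h1.1, h1.2.symm⟩

/-! ### Nondegeneracy of the Osterwalder–Schrader form -/

lemma sum_reTrace_le {N n : ℕ} (S : Finset (Bond n)) (p : Config N n × Config N n) :
    ∑ b ∈ S, 2 * (Matrix.trace (p.1 b * (p.2 b)⁻¹).1).re ≤ S.card * (2 * N) := by
  refine (Finset.sum_le_card_nsmul _ _ (2 * N : ℝ) fun b _ => ?_).trans_eq (nsmul_eq_mul _ _)
  have := (abs_le.mp (abs_re_trace_le (p.1 b * (p.2 b)⁻¹))).2
  linarith

lemma couplingKernel_add {N n : ℕ} (β γ : ℝ) (S : Finset (Bond n)) :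
    couplingKernel N (β + γ) S = couplingKernel N β S * couplingKernel N γ S := by
  rw [couplingKernel, couplingKernel, couplingKernel, ← NormedSpace.exp_add, ← add_smul,
    Complex.ofReal_add]

lemma couplingKernel_union {N n : ℕ} (β : ℝ) {S B : Finset (Bond n)} (h : S ⊆ B) :
    couplingKernel N β B = couplingKernel N β (B \ S) * couplingKernel N β S := by
  rw [couplingKernel, couplingKernel, couplingKernel, ← NormedSpace.exp_add, ← smul_add,
    Finset.sum_sdiff h]

/-- On squares of absolute values, weakening the coupling on finitely many bonds changes the form
at most by a factor. -/
lemma re_kernelForm_le {N n : ℕ} {β : ℝ} (hβ : 0 ≤ β) (S T : Finset (Bond n)) (γ δ : ℝ)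
    {φ : C(Config N n, ℂ)} (hφ : ∀ p, 0 ≤ tensor φ p) :
    (kernelForm (haarProduct N n) φ
      (couplingKernel N γ T * couplingKernel N δ S * couplingKernel N β S)).re ≤
      Real.exp (β * (S.card * (2 * N))) * (kernelForm (haarProduct N n) φ
        (couplingKernel N γ T * couplingKernel N δ S)).re := by
  unfold kernelForm
  have hi : ∀ K : C(Config N n × Config N n, ℂ), Integrable (fun p => tensor φ p * K p)
      ((haarProduct N n).prod (haarProduct N n)) :=
    fun K => integrable_of_continuous _ (by fun_prop)
  have hre := fun K => (integral_re (𝕜 := ℂ) (hi K)).symm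
  simp only [RCLike.re_to_complex] at hre
  rw [hre, hre, ← integral_const_mul]
  refine integral_mono (hi _).re ((hi _).re.const_mul _) fun p => ?_
  simp only [ContinuousMap.mul_apply, couplingKernel_apply]
  obtain ⟨r, hr, hrp⟩ : ∃ r : ℝ, 0 ≤ r ∧ tensor φ p = r :=
    ⟨(tensor φ p).re, (Complex.le_def.mp (hφ p)).1,
      Complex.ext rfl (Complex.le_def.mp (hφ p)).2.symm⟩
  rw [hrp]
  simp only [← Complex.ofReal_mul, Complex.ofReal_re]
  have h1 := Real.exp_le_exp.mpr (mul_le_mul_of_nonneg_left (sum_reTrace_le S p) hβ)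
  set x := Real.exp (γ * ∑ b ∈ T, 2 * (Matrix.trace (p.1 b * (p.2 b)⁻¹).1).re) with hx
  set y := Real.exp (δ * ∑ b ∈ S, 2 * (Matrix.trace (p.1 b * (p.2 b)⁻¹).1).re) with hy
  have h2 : 0 ≤ r * (x * y) := mul_nonneg hr (by positivity)
  calc _ = r * (x * y) * _ := by rw [mul_assoc r]
    _ ≤ r * (x * y) * _ := mul_le_mul_of_nonneg_left h1 h2
    _ = _ := by rw [mul_comm]

/-- A bound of `⟨|F|² Θ|F|²⟩_Λ` by `⟨F ΘF⟩_Λ`, uniform in `Λ`. The constant depends only on `β`, `S`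
and the domination of `F^*`, since the half-space weights and the coupling off `S` occur identically
on both sides. -/
lemma exists_correlation_osFun_le {N n : ℕ} {β : ℝ} (hβ : 0 < β) {F : C(Config N n, ℂ)}
    (hF : F ∈ observables N n) (hF' : star F ∈ observables N n) {S : Finset (Bond n)}
    (hS : star F ∈ bondPolynomials N (S : Set (Bond n))) :
    ∃ c : ℝ, ∀ Λ : Finset (Site n), (∀ x ∈ Λ, timeReflect x ∈ Λ) → S ⊆ couplingBonds Λ →
      (correlation β Λ (osFun (F * star F))).re ≤ c * (correlation β Λ (osFun F)).re := by
  obtain ⟨c, -, hc⟩ := bondPolynomials_le_dominated N S hS (β / 2) (half_pos hβ)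
  refine ⟨Real.exp (β / 2 * (S.card * (2 * N))) * c, fun Λ hΛ hSΛ => ?_⟩
  rw [correlation_osFun β hF hΛ, correlation_osFun β (mul_mem hF hF') hΛ,
    Complex.re_ofReal_mul, Complex.re_ofReal_mul, mul_left_comm]
  refine mul_le_mul_of_nonneg_left ?_ (osFactor_nonneg N β Λ)
  -- One half of the coupling on `S` pays for the domination of `F^* ⊗ F`; the rest is a positive
  -- multiplier.
  have hsplit : couplingKernel N β (couplingBonds Λ) =
      couplingKernel N β (couplingBonds Λ \ S) * couplingKernel N (β / 2) S *
        couplingKernel N (β / 2) S := by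
    rw [couplingKernel_union β hSΛ, mul_assoc, ← couplingKernel_add, add_halves]
  have hK := mul_mem (mul_mem (couplingKernel_mem hβ.le (couplingBonds Λ \ S))
    (couplingKernel_mem (half_pos hβ).le S)) hc
  have hpos := isPosKernel_of_mem _ hK (F * upperWeight N β Λ)
  have hcoupling : NormedSpace.exp (((β / 2 : ℝ) : ℂ) • ∑ b ∈ S, bondKernel N b) =
    couplingKernel N (β / 2) S := rfl
  rw [mul_sub, kernelForm_sub, kernelForm_mul_tensor, mul_smul_comm, kernelForm_smul,
    hcoupling, ← hsplit] at hpos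
  have hpos' := (Complex.le_def.mp hpos).1
  rw [Complex.sub_re, Complex.re_ofReal_mul, Complex.zero_re, sub_nonneg] at hpos'
  have hcomm : F * upperWeight N β Λ * star F = F * star F * upperWeight N β Λ := by ring
  rw [hcomm] at hpos'
  -- The spent half of the coupling is restored by a pointwise bound. This needs a nonnegative
  -- integrand, which holds because `F` has become `|F|²`.
  have hle := re_kernelForm_le (N := N) (half_pos hβ).le S (couplingBonds Λ \ S) β (β / 2)
    (φ := F * star F * upperWeight N β Λ) (fun p => by
      have hval : ∀ V : Config N n, (F * star F * upperWeight N β Λ) V =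
          ((Complex.normSq (F V) * Real.exp (-β * upperAction Λ V) : ℝ) : ℂ) := fun V => by
        rw [Complex.ofReal_mul, ← Complex.mul_conj]
        rfl
      rw [tensor_apply, hval, hval, Complex.conj_ofReal, ← Complex.ofReal_mul]
      have := Complex.normSq_nonneg (F p.1)
      have := Complex.normSq_nonneg (F p.2)
      exact_mod_cast by positivity)
  rw [hsplit] at hpos' ⊢
  refine hle.trans ?_
  rw [mul_assoc (Real.exp _)]
  exact mul_le_mul_of_nonneg_left hpos' (Real.exp_nonneg _)

end ReflectionPositivity

/-! ### Local lower bounds on the Gibbs measures -/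

/-- Only plaquettes with an edge in `S` can change. Their base points lie in a finite set
independent of `Λ`, and each energy, bounded by `4N` in absolute value, changes by at most `8N`. -/
lemma exists_wilsonAction_splice_le (N : ℕ) {n : ℕ} (S : Finset (Bond n)) :
    ∃ M : ℝ, ∀ (Λ : Finset (Site n)) (U V : Config N n),
      wilsonAction Λ (splice (S : Set (Bond n)) U V) ≤ wilsonAction Λ V + M := by
  classical
  let T : Finset (Site n × Fin (n + 1) × Fin (n + 1)) :=
    (S.biUnion fun b => insert b.1 (Finset.univ.image fun ρ => b.1 - Pi.single ρ 1)) ×ˢ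
      Finset.univ ×ˢ Finset.univ
  have hT : ∀ q ∉ T, ∀ U V : Config N n,
      plaquetteEnergy (splice (S : Set (Bond n)) U V) q = plaquetteEnergy V q := by
    rintro ⟨x, μ, ν⟩ hq U V
    have hx : ∀ b ∈ S, x ≠ b.1 ∧ ∀ ρ, shift x ρ ≠ b.1 := by
      intro b hb
      simp only [T, Finset.mem_product, Finset.mem_univ, and_true, Finset.mem_biUnion,
        Finset.mem_insert, Finset.mem_image, true_and, not_exists, not_and, not_or] at hq
      exact ⟨(hq b hb).1, fun ρ h => (hq b hb).2 ρ (by rw [← h, shift, add_sub_cancel_right])⟩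
    have h0 : ∀ ρ, (x, ρ) ∉ (S : Set (Bond n)) := fun ρ h => (hx _ h).1 rfl
    have h1 : ∀ ρ σ, (shift x ρ, σ) ∉ (S : Set (Bond n)) := fun ρ σ h => (hx _ h).2 ρ rfl
    simp only [plaquetteEnergy, plaquetteVar, splice_of_notMem U V (h0 _),
      splice_of_notMem U V (h1 _ _)]
  refine ⟨T.card * (8 * N), fun Λ U V => ?_⟩
  rw [wilsonAction_eq_sum, wilsonAction_eq_sum, ← sub_le_iff_le_add', ← Finset.sum_sub_distrib]
  have h2 : ∀ q ∈ plaquettes Λ,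
      plaquetteEnergy (splice (S : Set (Bond n)) U V) q - plaquetteEnergy V q ≤
        if q ∈ T then (8 * N : ℝ) else 0 := by
    intro q _
    split_ifs with h
    · have := (abs_le.mp (abs_plaquetteEnergy_le (splice (S : Set (Bond n)) U V) q)).2
      have := (abs_le.mp (abs_plaquetteEnergy_le V q)).1
      linarith
    · rw [hT q h, sub_self]
  refine (Finset.sum_le_sum h2).trans ?_
  rw [Finset.sum_ite_mem, Finset.sum_const, nsmul_eq_mul]
  refine mul_le_mul_of_nonneg_right ?_ (by positivity)
  exact_mod_cast Finset.card_le_card Finset.inter_subset_right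

/-- Resampling the bonds of `S` from Haar measure raises the action by at most a constant `M`, so
the marginal of the Gibbs measure on `S` is at least `exp (-β M)` times Haar measure, in every
volume. -/
lemma exists_lowerBound_expectation (N : ℕ) {n : ℕ} {β : ℝ} (hβ : 0 ≤ β) (S : Finset (Bond n)) :
    ∃ c : ℝ, 0 < c ∧ ∀ (Λ : Finset (Site n)) (f : Config N n → ℝ), Continuous f →
      (∀ U, 0 ≤ f U) → (∀ U V, (∀ b ∈ S, U b = V b) → f U = f V) →
      c * ∫ U, f U ∂(haarProduct N n) ≤ (partitionFunction N β Λ)⁻¹ *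
        ∫ U, f U * Real.exp (-β * wilsonAction Λ U) ∂(haarProduct N n) := by
  obtain ⟨M, hM⟩ := exists_wilsonAction_splice_le N S
  refine ⟨Real.exp (-β * M), Real.exp_pos _, fun Λ f hf hf0 hfS => ?_⟩
  have hZ := partitionFunction_pos N β Λ
  rw [le_inv_mul_iff₀ hZ]
  have hcw : Continuous fun U : Config N n => Real.exp (-β * wilsonAction Λ U) :=
    Real.continuous_exp.comp (continuous_const.mul (continuous_wilsonAction Λ))
  have hc : Continuous fun U : Config N n => f U * Real.exp (-β * wilsonAction Λ U) := hf.mul hcw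
  have hsp := measurePreserving_splice N (S : Set (Bond n))
  have hcs : Continuous fun p : Config N n × Config N n =>
      f (splice (S : Set (Bond n)) p.1 p.2) *
        Real.exp (-β * wilsonAction Λ (splice (S : Set (Bond n)) p.1 p.2)) :=
    hc.comp (continuous_splice _ continuous_fst continuous_snd)
  rw [← hsp.map_eq, integral_map hsp.measurable.aemeasurable hc.aestronglyMeasurable, hsp.map_eq]
  have h1 : partitionFunction N β Λ * (Real.exp (-β * M) * ∫ U, f U ∂(haarProduct N n)) =
      ∫ p : Config N n × Config N n, Real.exp (-β * M) *
        (f p.1 * Real.exp (-β * wilsonAction Λ p.2))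
        ∂((haarProduct N n).prod (haarProduct N n)) := by
    rw [integral_const_mul, integral_prod_mul f
      (fun U => Real.exp (-β * wilsonAction Λ U)), partitionFunction]
    ring
  rw [h1]
  refine integral_mono (integrable_of_continuous _ (continuous_const.mul
    ((hf.comp continuous_fst).mul (hcw.comp continuous_snd)))) (integrable_of_continuous _ hcs) fun p => ?_
  have h2 : f (splice (S : Set (Bond n)) p.1 p.2) = f p.1 :=
    hfS _ _ fun b hb => splice_of_mem p.1 p.2 hb
  simp only [h2]
  rw [mul_left_comm, ← Real.exp_add]
  refine mul_le_mul_of_nonneg_left (Real.exp_le_exp.mpr ?_) (hf0 _)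
  have := mul_le_mul_of_nonneg_left (hM Λ p.1 p.2) hβ
  linarith

instance instIsOpenPosMeasureHaarProduct (N n : ℕ) :
    (haarProduct N n).IsOpenPosMeasure := by
  constructor
  rintro O hO ⟨U, hU⟩
  obtain ⟨I, u, hu, hsub⟩ := isOpen_pi_iff.mp hO U hU
  refine fun h0 => ?_
  have h1 := measure_mono_null hsub h0
  rw [haarProduct, Measure.infinitePi_pi _ fun b hb => (hu b hb).1.measurableSet,
    Finset.prod_eq_zero_iff] at h1
  obtain ⟨b, hb, h2⟩ := h1
  exact ((hu b hb).1.measure_pos (haarSU N) ⟨U b, (hu b hb).2⟩).ne' h2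

lemma re_osFun_mul_star {N n : ℕ} (F : C(Config N n, ℂ)) (U : Config N n) :
    (osFun (F * star F) U).re =
      Complex.normSq (F U) * Complex.normSq (F (reflectConfig N n U)) := by
  have : ∀ V, (F * star F) V = (Complex.normSq (F V) : ℝ) := fun V => by
    rw [← Complex.mul_conj]; rfl
  rw [osFun_apply, this, this, Complex.conj_ofReal, ← Complex.ofReal_mul, Complex.ofReal_re]

lemma re_correlation {N n : ℕ} (β : ℝ) (Λ : Finset (Site n)) (F : C(Config N n, ℂ)) :
    (correlation β Λ F).re = (partitionFunction N β Λ)⁻¹ *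
      ∫ U, (F U).re * Real.exp (-β * wilsonAction Λ U) ∂(haarProduct N n) := by
  have hi : Integrable (fun U => F U * (Real.exp (-β * wilsonAction Λ U) : ℂ))
      (haarProduct N n) :=
    integrable_of_continuous _ (F.continuous.mul (Complex.continuous_ofReal.comp
      (Real.continuous_exp.comp (continuous_const.mul (continuous_wilsonAction Λ)))))
  rw [correlation, ← Complex.ofReal_inv, Complex.re_ofReal_mul]
  congr 1
  have := (integral_re (𝕜 := ℂ) hi).symm
  simp only [RCLike.re_to_complex] at this
  rw [this]
  congr 1
  ext1 U
  rw [Complex.re_mul_ofReal]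

/-- The form is bounded below, up to constants uniform in the volume, by the Haar integral of
`|F(U)|² |F(θU)|²`, with `θ` the reflection. This integral is positive because the integrand is
continuous, nonnegative and nonzero at `U₀`. -/
lemma osForm_self_pos {N n : ℕ} {β : ℝ} (hβ : 0 < β) {m : ProbabilityMeasure (Config N n)}
    (hm : IsThermodynamicLimit β m) {F : C(Config N n, ℂ)} (hF : F ∈ observables N n)
    (hF' : star F ∈ observables N n) {S : Finset (Bond n)} (hSh : ↑S ⊆ halfBonds n)
    (hS : F ∈ bondPolynomials N (S : Set (Bond n)))
    (hS' : star F ∈ bondPolynomials N (S : Set (Bond n)))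
    {U₀ : Config N n} (h₀ : F U₀ ≠ 0) (h₁ : F (reflectConfig N n U₀) ≠ 0) :
    0 < (osForm m F F).re := by
  classical
  have hrp := (isReflectionPositive_of_isThermodynamicLimit hβ.le hm F hF).1
  obtain ⟨l, hl, hla, hlim⟩ := hm
  obtain ⟨c, hc⟩ := exists_correlation_osFun_le hβ hF hF' hS'
  obtain ⟨s, hs⟩ := exists_subset_couplingBonds S hSh
  obtain ⟨d, hd, hbound⟩ := exists_lowerBound_expectation N hβ.le (S ∪ S.image reflectBond)
  let f : Config N n → ℝ := fun U => (osFun (F * star F) U).re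
  have hf : Continuous f := Complex.continuous_re.comp (osFun _).continuous
  have hf0 : ∀ U, 0 ≤ f U := fun U => by
    simp only [f, re_osFun_mul_star]
    exact mul_nonneg (Complex.normSq_nonneg _) (Complex.normSq_nonneg _)
  have hfS : ∀ U V, (∀ b ∈ S ∪ S.image reflectBond, U b = V b) → f U = f V := by
    intro U V h
    simp only [f, re_osFun_mul_star]
    rw [bondPolynomials_congr hS fun b hb => h b (Finset.mem_union_left _ hb),
      bondPolynomials_congr hS (U := reflectConfig N n U) (V := reflectConfig N n V) fun b hb => ?_]
    rw [reflectConfig_apply, reflectConfig_apply,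
      h _ (Finset.mem_union_right _ (Finset.mem_image_of_mem _ hb))]
  have hfpos : 0 < ∫ U, f U ∂(haarProduct N n) := by
    rw [integral_pos_iff_support_of_nonneg hf0 (integrable_of_continuous _ hf)]
    refine hf.isOpen_support.measure_pos _ ⟨U₀, ?_⟩
    simp only [f, Function.mem_support, re_osFun_mul_star]
    exact mul_ne_zero (by simpa using h₀) (by simpa using h₁)
  have h1 : d * ∫ U, f U ∂(haarProduct N n) ≤ c * (osForm m F F).re := by
    refine ge_of_tendsto (((Complex.continuous_re.tendsto _).comp
      (hlim (osFun F))).const_mul c) ?_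
    -- Volumes are reflection invariant, so `s` is symmetrized before it can serve as a lower bound.
    have hev : ∀ᶠ Λ : Volume n in atTop, s ⊆ Λ.1 := by
      refine (eventually_ge_atTop (⟨s ∪ s.image timeReflect, fun x hx => ?_⟩ : Volume n)).mono
        fun Λ h => Finset.subset_union_left.trans h
      rcases Finset.mem_union.mp hx with h | h
      · exact Finset.mem_union_right _ (Finset.mem_image_of_mem _ h)
      · obtain ⟨y, hy, rfl⟩ := Finset.mem_image.mp h
        rw [timeReflect_timeReflect]
        exact Finset.mem_union_left _ hy
    filter_upwards [hla hev] with Λ hΛ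
    refine (hbound Λ.1 f hf hf0 hfS).trans ?_
    rw [← re_correlation]
    exact hc Λ.1 Λ.2 (hs Λ.1 hΛ)
  refine lt_of_le_of_ne hrp fun h => ?_
  rw [← h, mul_zero] at h1
  exact absurd h1 (not_le.mpr (mul_pos hd hfpos))

/-! ### Existence of thermodynamic limits -/

/-- The finite volume Gibbs measure. -/
noncomputable def gibbsMeasure (N : ℕ) {n : ℕ} (β : ℝ) (Λ : Finset (Site n)) :
    ProbabilityMeasure (Config N n) :=
  ⟨(haarProduct N n).tilted fun U => -β * wilsonAction Λ U,
    isProbabilityMeasure_tilted (integrable_exp_neg_wilsonAction β Λ)⟩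

lemma integral_gibbsMeasure {N n : ℕ} (β : ℝ) (Λ : Finset (Site n)) (F : C(Config N n, ℂ)) :
    ∫ U, F U ∂(gibbsMeasure N β Λ : Measure (Config N n)) = correlation β Λ F := by
  change ∫ U, F U ∂((haarProduct N n).tilted fun U => -β * wilsonAction Λ U) = _
  rw [integral_tilted, correlation, ← integral_const_mul]
  congr 1
  ext1 U
  rw [Complex.real_smul, div_eq_mul_inv]
  change ((_ * (partitionFunction N β Λ)⁻¹ : ℝ) : ℂ) * _ = _
  push_cast
  ring

instance instIsDirectedOrderVolume (n : ℕ) : IsDirectedOrder (Volume n) := by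
  classical
  refine ⟨fun Λ Λ' => ⟨⟨Λ.1 ∪ Λ'.1, fun x hx => ?_⟩, Finset.subset_union_left,
    Finset.subset_union_right⟩⟩
  rcases Finset.mem_union.mp hx with h | h
  · exact Finset.mem_union_left _ (Λ.2 x h)
  · exact Finset.mem_union_right _ (Λ'.2 x h)

instance instNonemptyVolume (n : ℕ) : Nonempty (Volume n) := ⟨⟨∅, by simp⟩⟩

/-- By compactness of the space of probability measures, the Gibbs measures converge along any
ultrafilter finer than `atTop`. -/
lemma exists_isThermodynamicLimit (N n : ℕ) (β : ℝ) :
    ∃ m : ProbabilityMeasure (Config N n), IsThermodynamicLimit β m := by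
  let l : Ultrafilter (Volume n) := Ultrafilter.of atTop
  let ν : Volume n → ProbabilityMeasure (Config N n) := fun Λ => gibbsMeasure N β Λ.1
  obtain ⟨m, -, hm⟩ := isCompact_univ.ultrafilter_le_nhds (l.map ν) (by simp)
  refine ⟨m, l, inferInstance, Ultrafilter.of_le _, fun F => ?_⟩
  have h : Tendsto ν l (𝓝 m) := hm
  rw [ProbabilityMeasure.tendsto_iff_forall_integral_rclike_tendsto ℂ] at h
  have h2 := h (BoundedContinuousFunction.mkOfCompact F)
  simp only [BoundedContinuousFunction.mkOfCompact_apply] at h2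
  simpa only [ν, integral_gibbsMeasure] using h2

/-! ### Charge conjugation invariance -/

lemma correlation_comp_conjConfig {N n : ℕ} (β : ℝ) (Λ : Finset (Site n))
    (F : C(Config N n, ℂ)) :
    correlation β Λ (F.comp (conjConfig N n)) = correlation β Λ F := by
  have hc : Continuous fun U : Config N n => F U * (Real.exp (-β * wilsonAction Λ U) : ℂ) :=
    F.continuous.mul (Complex.continuous_ofReal.comp
      (Real.continuous_exp.comp (continuous_const.mul (continuous_wilsonAction Λ))))
  rw [correlation, correlation,
    ← integral_comp_of_measurePreserving (measurePreserving_conjConfig N n) hc]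
  simp only [wilsonAction_conjConfig, ContinuousMap.comp_apply]

lemma IsThermodynamicLimit.integral_comp_conjConfig {N n : ℕ} {β : ℝ}
    {m : ProbabilityMeasure (Config N n)} (hm : IsThermodynamicLimit β m)
    (F : C(Config N n, ℂ)) :
    ∫ U, F (conjConfig N n U) ∂(m : Measure (Config N n)) =
      ∫ U, F U ∂(m : Measure (Config N n)) := by
  obtain ⟨l, hl, -, h⟩ := hm
  have h1 := h (F.comp (conjConfig N n))
  simp only [correlation_comp_conjConfig] at h1
  exact tendsto_nhds_unique h1 (h F)

lemma conjConfig_conjConfig {N n : ℕ} (U : Config N n) :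
    conjConfig N n (conjConfig N n U) = U :=
  funext fun b => conjSU_conjSU (U b)

lemma chargeConjFun_chargeConjFun {N n : ℕ} (F : C(Config N n, ℂ)) :
    chargeConjFun N n (chargeConjFun N n F) = F := by
  ext U
  exact congrArg F (conjConfig_conjConfig U)

/-- Conjugation preserves the limit measure and commutes with time reflection. -/
lemma IsThermodynamicLimit.osForm_chargeConjFun {N n : ℕ} {β : ℝ}
    {m : ProbabilityMeasure (Config N n)} (hm : IsThermodynamicLimit β m)
    (G F : C(Config N n, ℂ)) :
    osForm m (chargeConjFun N n G) (chargeConjFun N n F) = osForm m G F := by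
  have h := hm.integral_comp_conjConfig (F * star (G.comp (reflectConfig N n)))
  refine Eq.trans ?_ h
  unfold osForm
  congr 1
  ext1 U
  change F (conjConfig N n U) * conj (G (conjConfig N n (reflectConfig N n U))) =
    F (conjConfig N n U) * conj (G (reflectConfig N n (conjConfig N n U)))
  rw [conjConfig_reflectConfig]

/-! ### Charge conjugation as an operator on the physical Hilbert space -/

section Operator

variable {N n : ℕ} {m : ProbabilityMeasure (Config N n)} (h : IsReflectionPositive m)

lemma denseRange_vec : DenseRange (vec h) :=
  UniformSpace.Completion.denseRange_coe (α := PreHilbert m h)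

lemma norm_preHilbert_sq (F : PreHilbert m h) :
    ‖F‖ ^ 2 = (osForm m (Subtype.val (p := (· ∈ observables N n)) F)
      (Subtype.val (p := (· ∈ observables N n)) F)).re :=
  (inner_self_eq_norm_sq (𝕜 := ℂ) F).symm

lemma vec_ne_zero {F : observables N n} (hF : 0 < (osForm m F.1 F.1).re) : vec h F ≠ 0 := by
  intro h0
  have := inner_vec h F F
  rw [h0, inner_zero_left] at this
  rw [← this] at hF
  simp at hF

/-- Invariance of the form makes conjugation of observables isometric for the seminorm; it therefore
respects null vectors and extends to the completion. -/
lemma exists_chargeConjugation {β : ℝ} (hm : IsThermodynamicLimit β m) :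
    ∃ C : PhysicalSpace m h →L[ℂ] PhysicalSpace m h, IsChargeConjugation h C := by
  let T : PreHilbert m h →ₗ[ℂ] PreHilbert m h :=
    { toFun := fun F => (chargeConj (show observables N n from F) : observables N n)
      map_add' := fun F G => Subtype.ext (map_add (chargeConjFun N n) _ _)
      map_smul' := fun c F => Subtype.ext (map_smul (chargeConjFun N n) c _) }
  have hT : ∀ F, ‖T F‖ ≤ 1 * ‖F‖ := fun F => by
    rw [one_mul, ← abs_norm (T F), ← abs_norm F]
    refine sq_le_sq.mp ?_
    rw [norm_preHilbert_sq, norm_preHilbert_sq]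
    exact (congrArg Complex.re (hm.osForm_chargeConjFun _ _)).le
  exact ⟨(T.mkContinuous 1 hT).completion, fun F =>
    UniformSpace.Completion.map_coe (T.mkContinuous 1 hT).uniformContinuous
      (show PreHilbert m h from F)⟩

variable {h}

lemma IsChargeConjugation.unique {C C' : PhysicalSpace m h →L[ℂ] PhysicalSpace m h}
    (hC : IsChargeConjugation h C) (hC' : IsChargeConjugation h C') : C' = C := by
  refine ContinuousLinearMap.ext fun v => ?_
  refine congrFun ((denseRange_vec h).equalizer C'.continuous C.continuous ?_) v
  ext1 F
  exact (hC' F).trans (hC F).symm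

lemma IsChargeConjugation.mul_self {C : PhysicalSpace m h →L[ℂ] PhysicalSpace m h}
    (hC : IsChargeConjugation h C) : C * C = 1 := by
  refine ContinuousLinearMap.ext fun v => ?_
  refine congrFun ((denseRange_vec h).equalizer (C * C).continuous continuous_id ?_) v
  ext1 F
  change C (C (vec h F)) = vec h F
  rw [hC, hC]
  exact congrArg (vec h) (Subtype.ext (chargeConjFun_chargeConjFun F.1))

lemma IsChargeConjugation.inner_map_map {β : ℝ} (hm : IsThermodynamicLimit β m)
    {C : PhysicalSpace m h →L[ℂ] PhysicalSpace m h} (hC : IsChargeConjugation h C)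
    (v w : PhysicalSpace m h) : inner ℂ (C v) (C w) = inner ℂ v w := by
  refine UniformSpace.Completion.induction_on₂ v w
    (isClosed_eq (by fun_prop) (by fun_prop)) fun G F => ?_
  let G' : observables N n := G
  let F' : observables N n := F
  have h1 := inner_vec h (chargeConj G') (chargeConj F')
  have h2 := inner_vec h G' F'
  rw [← hC G', ← hC F'] at h1
  refine h1.trans (Eq.trans ?_ h2.symm)
  exact hm.osForm_chargeConjFun _ _

/-- For an isometric involution, `⟨v, C w⟩ = ⟨C v, C C w⟩ = ⟨C v, w⟩`. -/
lemma IsChargeConjugation.isSelfAdjoint {β : ℝ} (hm : IsThermodynamicLimit β m)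
    {C : PhysicalSpace m h →L[ℂ] PhysicalSpace m h} (hC : IsChargeConjugation h C) :
    IsSelfAdjoint C := by
  rw [ContinuousLinearMap.isSelfAdjoint_iff_isSymmetric]
  intro v w
  change inner ℂ (C v) w = inner ℂ v (C w)
  rw [← hC.inner_map_map hm v (C w)]
  congr 1
  exact (DFunLike.congr_fun hC.mul_self w).symm

end Operator

/-! ### Self-adjoint involutions -/

section Involution

variable {H : Type*} [NormedAddCommGroup H] [InnerProductSpace ℂ H] {C : H →L[ℂ] H}

lemma apply_apply_of_mul_self (hC : C * C = 1) (v : H) : C (C v) = v :=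
  DFunLike.congr_fun hC v

lemma projPlus_apply (v : H) : projPlus C v = (1 / 2 : ℂ) • (v + C v) := rfl

lemma projMinus_apply (v : H) : projMinus C v = (1 / 2 : ℂ) • (v - C v) := rfl

lemma projPlus_eq_self {v : H} (hv : C v = v) : projPlus C v = v := by
  rw [projPlus_apply, hv]; module

lemma projMinus_eq_self {v : H} (hv : C v = -v) : projMinus C v = v := by
  rw [projMinus_apply, hv]; module

lemma mem_sectorPlus (hC : C * C = 1) (v : H) : v ∈ sectorPlus C ↔ C v = v := by
  constructor
  · rintro ⟨w, rfl⟩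
    change C (projPlus C w) = projPlus C w
    rw [projPlus_apply, map_smul, map_add, apply_apply_of_mul_self hC, add_comm]
  · exact fun hv => ⟨v, projPlus_eq_self hv⟩

lemma mem_sectorMinus (hC : C * C = 1) (v : H) : v ∈ sectorMinus C ↔ C v = -v := by
  constructor
  · rintro ⟨w, rfl⟩
    change C (projMinus C w) = -projMinus C w
    rw [projMinus_apply, map_smul, map_sub, apply_apply_of_mul_self hC, ← smul_neg, neg_sub]
  · exact fun hv => ⟨v, projMinus_eq_self hv⟩

lemma projPlus_mul_projPlus (hC : C * C = 1) : projPlus C * projPlus C = projPlus C := by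
  ext v
  exact projPlus_eq_self ((mem_sectorPlus hC _).mp ⟨v, rfl⟩)

lemma projMinus_mul_projMinus (hC : C * C = 1) : projMinus C * projMinus C = projMinus C := by
  ext v
  exact projMinus_eq_self ((mem_sectorMinus hC _).mp ⟨v, rfl⟩)

lemma projPlus_mul_projMinus (hC : C * C = 1) : projPlus C * projMinus C = 0 := by
  ext v
  have : C (projMinus C v) = -projMinus C v := (mem_sectorMinus hC _).mp ⟨v, rfl⟩
  change projPlus C (projMinus C v) = 0
  rw [projPlus_apply, this, add_neg_cancel, smul_zero]

lemma projMinus_mul_projPlus (hC : C * C = 1) : projMinus C * projPlus C = 0 := by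
  ext v
  have : C (projPlus C v) = projPlus C v := (mem_sectorPlus hC _).mp ⟨v, rfl⟩
  change projMinus C (projPlus C v) = 0
  rw [projMinus_apply, this, sub_self, smul_zero]

lemma isCompl_sectors (hC : C * C = 1) : IsCompl (sectorPlus C) (sectorMinus C) := by
  constructor
  · rw [Submodule.disjoint_def]
    intro v hp hm
    rw [mem_sectorPlus hC] at hp
    rw [mem_sectorMinus hC, hp] at hm
    have h2 : (2 : ℂ) • v = 0 := by
      rw [two_smul]
      exact add_eq_zero_iff_eq_neg.mpr hm
    simpa using h2
  · rw [codisjoint_iff, Submodule.eq_top_iff']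
    intro v
    refine Submodule.mem_sup.mpr ⟨projPlus C v, ⟨v, rfl⟩, projMinus C v, ⟨v, rfl⟩, ?_⟩
    rw [projPlus_apply, projMinus_apply]
    module

variable [CompleteSpace H]

lemma inner_eq_zero_of_eigen (hC : IsSelfAdjoint C) {v w : H} (hv : C v = v) (hw : C w = -w) :
    inner ℂ v w = 0 := by
  have h : inner ℂ (C v) w = inner ℂ v (C w) :=
    ContinuousLinearMap.isSelfAdjoint_iff_isSymmetric.mp hC v w
  rw [hv, hw, inner_neg_right] at h
  exact self_eq_neg.mp h

lemma sectorPlus_isOrtho_sectorMinus (hC : C * C = 1) (hs : IsSelfAdjoint C) :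
    sectorPlus C ⟂ sectorMinus C := by
  rw [Submodule.isOrtho_iff_inner_eq]
  intro v hv w hw
  exact inner_eq_zero_of_eigen hs ((mem_sectorPlus hC v).mp hv) ((mem_sectorMinus hC w).mp hw)

lemma isSelfAdjoint_projPlus (hs : IsSelfAdjoint C) : IsSelfAdjoint (projPlus C) :=
  IsSelfAdjoint.smul (by simp [isSelfAdjoint_iff]) ((IsSelfAdjoint.one _).add hs)

lemma isSelfAdjoint_projMinus (hs : IsSelfAdjoint C) : IsSelfAdjoint (projMinus C) :=
  IsSelfAdjoint.smul (by simp [isSelfAdjoint_iff]) ((IsSelfAdjoint.one _).sub hs)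

end Involution

/-! ### Plaquette fields -/

/-- The edges of a plaquette in the hyperplane `x⁰ = 1/2`. -/
def HalfPlaquette.bonds {n : ℕ} (p : HalfPlaquette n) : Finset (Bond n) :=
  {(p.site, p.dir₁), (shift p.site p.dir₁, p.dir₂), (shift p.site p.dir₂, p.dir₁),
    (p.site, p.dir₂)}

lemma HalfPlaquette.dir₁_ne {n : ℕ} (p : HalfPlaquette n) : p.dir₁ ≠ 0 := p.dir₁_pos.ne'

lemma HalfPlaquette.dir₂_ne {n : ℕ} (p : HalfPlaquette n) : p.dir₂ ≠ 0 :=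
  (p.dir₁_pos.trans p.dir_lt).ne'

lemma HalfPlaquette.bonds_subset {n : ℕ} (p : HalfPlaquette n) :
    (p.bonds : Set (Bond n)) ⊆ halfBonds n := by
  intro b hb
  simp only [bonds, Finset.coe_insert, Finset.coe_singleton, Set.mem_insert_iff,
    Set.mem_singleton_iff] at hb
  have h1 := p.dir₁_ne
  have h2 := p.dir₂_ne
  have h0 := p.time_eq
  rcases hb with rfl | rfl | rfl | rfl
  · exact ⟨h0, h1⟩
  · exact ⟨(shift_apply_zero _ h1).trans h0, h2⟩
  · exact ⟨(shift_apply_zero _ h2).trans h0, h1⟩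
  · exact ⟨h0, h2⟩

lemma tracePlaquette_mem_bondPolynomials (N : ℕ) {n : ℕ} (p : HalfPlaquette n) :
    tracePlaquette N p ∈ bondPolynomials N (p.bonds : Set (Bond n)) := by
  rw [tracePlaquette_eq]
  refine sum_mem fun i _ => sum_mem fun j _ => sum_mem fun k _ => sum_mem fun l _ => ?_
  refine mul_mem (mul_mem (mul_mem ?_ ?_) ?_) ?_
  · exact Algebra.subset_adjoin ⟨_, by simp [HalfPlaquette.bonds], _, _, Or.inl rfl⟩
  · exact Algebra.subset_adjoin ⟨_, by simp [HalfPlaquette.bonds], _, _, Or.inl rfl⟩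
  · exact Algebra.subset_adjoin ⟨_, by simp [HalfPlaquette.bonds], _, _, Or.inr rfl⟩
  · exact Algebra.subset_adjoin ⟨_, by simp [HalfPlaquette.bonds], _, _, Or.inr rfl⟩

lemma star_tracePlaquette_mem_bondPolynomials (N : ℕ) {n : ℕ} (p : HalfPlaquette n) :
    star (tracePlaquette N p) ∈ bondPolynomials N (p.bonds : Set (Bond n)) := by
  rw [tracePlaquette_eq]
  simp only [star_sum, star_mul']
  refine sum_mem fun i _ => sum_mem fun j _ => sum_mem fun k _ => sum_mem fun l _ => ?_
  refine mul_mem (mul_mem (mul_mem ?_ ?_) ?_) ?_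
  · exact Algebra.subset_adjoin ⟨_, by simp [HalfPlaquette.bonds], _, _, Or.inr rfl⟩
  · exact Algebra.subset_adjoin ⟨_, by simp [HalfPlaquette.bonds], _, _, Or.inr rfl⟩
  · exact Algebra.subset_adjoin ⟨_, by simp [HalfPlaquette.bonds], _, _,
      Or.inl (star_star _)⟩
  · exact Algebra.subset_adjoin ⟨_, by simp [HalfPlaquette.bonds], _, _,
      Or.inl (star_star _)⟩

/-- A time reflection invariant configuration whose plaquette variable at `p` is `g`. -/
def fluxConfig {N n : ℕ} (p : HalfPlaquette n) (g : SU N) : Config N n :=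
  fun b => if b.2 = p.dir₁ ∧ b.1 p.dir₂ = p.site p.dir₂ then g else 1

/-- The flux sits on spatial bonds selected by a spatial coordinate only, and temporal bonds, which
reflection inverts, carry `1`. -/
lemma reflectConfig_fluxConfig {N n : ℕ} (p : HalfPlaquette n) (g : SU N) :
    reflectConfig N n (fluxConfig p g) = fluxConfig p g := by
  ext1 ⟨x, μ⟩
  rw [reflectConfig_apply]
  by_cases hμ : μ = 0
  · simp [fluxConfig, reflectBond, hμ, p.dir₁_ne.symm]
  · simp [fluxConfig, reflectBond, hμ, timeReflect, p.dir₂_ne]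

/-- Of the four edges of `p`, only the one from `p.site` along `dir₁` carries `g`: the parallel edge
is displaced along `dir₂`. -/
lemma tracePlaquette_fluxConfig {N n : ℕ} (p : HalfPlaquette n) (g : SU N) :
    tracePlaquette N p (fluxConfig p g) = Matrix.trace g.1 := by
  change Matrix.trace (plaquetteVar (fluxConfig p g) p.site p.dir₁ p.dir₂).1 = _
  simp [plaquetteVar, fluxConfig, p.dir_lt.ne', shift]

/-- The centre element `exp (2πi/N) • 1` has trace with imaginary part `N sin (2π/N)`, nonzero
because `0 < 2π/N < π` for `N ≥ 3`. -/
lemma exists_trace_im_ne_zero {N : ℕ} (hN : 3 ≤ N) :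
    ∃ g : SU N, (Matrix.trace g.1).im ≠ 0 := by
  have hN0 : (N : ℝ) ≠ 0 := by positivity
  have hN0' : (N : ℂ) ≠ 0 := by exact_mod_cast hN0
  set ζ : ℂ := Complex.exp ((2 * Real.pi / N : ℝ) * Complex.I) with hζ
  have h1 : ζ * conj ζ = 1 := by
    rw [Complex.mul_conj, Complex.normSq_eq_norm_sq, hζ, Complex.norm_exp_ofReal_mul_I]
    simp
  have h2 : ζ ^ N = 1 := by
    rw [hζ, ← Complex.exp_nat_mul, ← Complex.exp_two_pi_mul_I]
    congr 1
    push_cast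
    field_simp
  have hg : Matrix.scalar (Fin N) ζ ∈ Matrix.specialUnitaryGroup (Fin N) ℂ := by
    rw [Matrix.mem_specialUnitaryGroup_iff, Matrix.mem_unitaryGroup_iff]
    refine ⟨?_, by simp [h2]⟩
    simp only [Matrix.scalar_apply, Matrix.star_eq_conjTranspose, Matrix.diagonal_conjTranspose,
      Matrix.diagonal_mul_diagonal]
    rw [← Matrix.diagonal_one]
    congr 1
    ext1 i
    exact h1
  refine ⟨⟨_, hg⟩, ?_⟩
  have h3 : Matrix.trace (Matrix.scalar (Fin N) ζ) = (N : ℝ) * ζ := by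
    simp [Matrix.trace]
  change (Matrix.trace (Matrix.scalar (Fin N) ζ)).im ≠ 0
  rw [h3, Complex.im_ofReal_mul, hζ, Complex.exp_ofReal_mul_I_im]
  refine mul_ne_zero hN0 (Real.sin_pos_of_pos_of_lt_pi (by positivity) ?_).ne'
  have : (3 : ℝ) ≤ N := by exact_mod_cast hN
  rw [div_lt_iff₀ (by linarith)]
  nlinarith [Real.pi_pos]

/-! ### Nonvanishing and charge parity of the plaquette fields -/

section Fields

variable {N n : ℕ} {β : ℝ} {m : ProbabilityMeasure (Config N n)}

lemma osForm_plaquettePlus_pos (hN : N ≠ 0) (hβ : 0 < β) (hm : IsThermodynamicLimit β m)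
    (p : HalfPlaquette n) :
    0 < (osForm m (plaquettePlus N p).1 (plaquettePlus N p).1).re := by
  have hval : (plaquettePlus N p).1 = tracePlaquette N p + star (tracePlaquette N p) := rfl
  have hstar : star (plaquettePlus N p).1 = (plaquettePlus N p).1 := by
    rw [hval, star_add, star_star, add_comm]
  have hS : (plaquettePlus N p).1 ∈ bondPolynomials N (p.bonds : Set (Bond n)) :=
    add_mem (tracePlaquette_mem_bondPolynomials N p) (star_tracePlaquette_mem_bondPolynomials N p)
  have h0 : (plaquettePlus N p).1 (fluxConfig p 1) ≠ 0 := by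
    rw [hval]
    change tracePlaquette N p (fluxConfig p 1) + conj (tracePlaquette N p (fluxConfig p 1)) ≠ 0
    rw [tracePlaquette_fluxConfig, Complex.add_conj]
    simpa using hN
  exact osForm_self_pos hβ hm (plaquettePlus N p).2 (by rw [hstar]; exact (plaquettePlus N p).2)
    p.bonds_subset hS (by rwa [hstar]) h0 (by rwa [reflectConfig_fluxConfig])

lemma osForm_plaquetteMinus_pos (hN : 3 ≤ N) (hβ : 0 < β) (hm : IsThermodynamicLimit β m)
    (p : HalfPlaquette n) :
    0 < (osForm m (plaquetteMinus N p).1 (plaquetteMinus N p).1).re := by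
  have hval : (plaquetteMinus N p).1 = tracePlaquette N p - star (tracePlaquette N p) := rfl
  have hstar : star (plaquetteMinus N p).1 = -(plaquetteMinus N p).1 := by
    rw [hval, star_sub, star_star, neg_sub]
  have hS : (plaquetteMinus N p).1 ∈ bondPolynomials N (p.bonds : Set (Bond n)) :=
    sub_mem (tracePlaquette_mem_bondPolynomials N p) (star_tracePlaquette_mem_bondPolynomials N p)
  obtain ⟨g, hg⟩ := exists_trace_im_ne_zero hN
  have h0 : (plaquetteMinus N p).1 (fluxConfig p g) ≠ 0 := by
    rw [hval]
    change tracePlaquette N p (fluxConfig p g) - conj (tracePlaquette N p (fluxConfig p g)) ≠ 0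
    rw [tracePlaquette_fluxConfig, Complex.sub_conj]
    simpa using hg
  exact osForm_self_pos hβ hm (plaquetteMinus N p).2
    (by rw [hstar]; exact neg_mem (plaquetteMinus N p).2)
    p.bonds_subset hS (by rw [hstar]; exact neg_mem hS) h0 (by rwa [reflectConfig_fluxConfig])

variable {h : IsReflectionPositive m}

lemma chargeConj_plaquettePlus (p : HalfPlaquette n) :
    chargeConj (plaquettePlus N p) = plaquettePlus N p := by
  refine Subtype.ext ?_
  change chargeConjFun N n (tracePlaquette N p + star (tracePlaquette N p)) = _
  rw [map_add, ← star_tracePlaquette, chargeConjFun_chargeConjFun, star_tracePlaquette, add_comm]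
  rfl

lemma chargeConj_plaquetteMinus (p : HalfPlaquette n) :
    chargeConj (plaquetteMinus N p) = -plaquetteMinus N p := by
  refine Subtype.ext ?_
  change chargeConjFun N n (tracePlaquette N p - star (tracePlaquette N p)) =
    -(tracePlaquette N p - star (tracePlaquette N p))
  rw [map_sub, ← star_tracePlaquette, chargeConjFun_chargeConjFun, star_tracePlaquette, neg_sub]

lemma vec_neg (F : observables N n) : vec h (-F) = -vec h F :=
  UniformSpace.Completion.coe_neg (α := PreHilbert m h) F

end Fields

/-! ### The gauge group `SU(2)` -/

/-- The element of `SU(2)` that conjugates `U` to `U^*`. -/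
noncomputable def conjugator : SU 2 :=
  ⟨!![0, 1; -1, 0], by
    rw [Matrix.mem_specialUnitaryGroup_iff, Matrix.mem_unitaryGroup_iff]
    refine ⟨?_, by simp [Matrix.det_fin_two]⟩
    ext i j
    fin_cases i <;> fin_cases j <;> simp [Matrix.mul_apply, Fin.sum_univ_two, Matrix.star_apply]⟩

/-- For determinant one, `U^†` is the adjugate, and for `2 × 2` matrices the adjugate is the
transpose conjugated by the antisymmetric matrix. -/
lemma conjSU_eq_conjugator_mul (U : SU 2) : conjSU U = conjugator * U * conjugator⁻¹ := by
  rw [eq_mul_inv_iff_mul_eq]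
  have h1 : star U.1 = U.1.adjugate := by
    have hdet : U.1.det = 1 := (Matrix.mem_specialUnitaryGroup_iff.mp U.2).2
    have h2 : star U.1 * U.1 = 1 := Matrix.mem_unitaryGroup_iff'.mp U.2.1
    calc star U.1 = star U.1 * (U.1 * U.1.adjugate) := by
          rw [Matrix.mul_adjugate, hdet, one_smul, mul_one]
      _ = U.1.adjugate := by rw [← mul_assoc, h2, one_mul]
  have h2 : ∀ i j, conj (U.1 j i) = U.1.adjugate i j := fun i j => congrFun (congrFun h1 i) j
  refine Subtype.ext ?_
  change U.1.map star * !![0, 1; -1, 0] = !![0, 1; -1, 0] * U.1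
  ext i j
  fin_cases i <;> fin_cases j <;>
    simp [Matrix.mul_apply, Fin.sum_univ_two, h2, Matrix.adjugate_fin_two]

/-- Since conjugation on `SU(2)` is inner, it is a constant gauge transformation. -/
lemma chargeConj_two {n : ℕ} (F : observables 2 n) : chargeConj F = F := by
  refine Subtype.ext (ContinuousMap.ext fun U => ?_)
  have : conjConfig 2 n U = gaugeConfig (fun _ => conjugator) U :=
    funext fun b => conjSU_eq_conjugator_mul (U b)
  change F.1 (conjConfig 2 n U) = F.1 U
  rw [this]
  exact F.2.2 _ U

end LatticeYM

/-! ### Assembly of the theorem -/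

open LatticeYM in
theorem mainTheorem1 (N n : ℕ) (hN : 2 ≤ N) (hn : 2 ≤ n) (β : ℝ) (hβ : 0 < β) :
    (∃ m : ProbabilityMeasure (Config N n), IsThermodynamicLimit β m) ∧
    ∀ m : ProbabilityMeasure (Config N n), IsThermodynamicLimit β m →
      ∃ h : IsReflectionPositive m, ∃ C : PhysicalSpace m h →L[ℂ] PhysicalSpace m h,
        IsChargeConjugation h C ∧
        (∀ C' : PhysicalSpace m h →L[ℂ] PhysicalSpace m h, IsChargeConjugation h C' → C' = C) ∧
        -- unitary, self-adjoint, involutive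
        C ∈ unitary (PhysicalSpace m h →L[ℂ] PhysicalSpace m h) ∧
        IsSelfAdjoint C ∧
        C * C = 1 ∧
        -- mutually orthogonal, orthogonal projections
        IsStarProjection (projPlus C) ∧
        IsStarProjection (projMinus C) ∧
        projPlus C * projMinus C = 0 ∧
        projMinus C * projPlus C = 0 ∧
        -- the orthogonal direct sum of the eigenspaces of `C`
        sectorPlus C ⟂ sectorMinus C ∧
        IsCompl (sectorPlus C) (sectorMinus C) ∧
        (∀ v, v ∈ sectorPlus C ↔ C v = v) ∧
        (∀ v, v ∈ sectorMinus C ↔ C v = -v) ∧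
        -- both sectors are present if `N ≠ 2`, and only one if `N = 2`
        (N ≠ 2 → sectorPlus C ≠ ⊥ ∧ sectorMinus C ≠ ⊥) ∧
        (N = 2 → C = 1 ∧ sectorPlus C = ⊤ ∧ sectorMinus C = ⊥) ∧
        -- the plaquette fields
        (∀ p : HalfPlaquette n,
          C (vec h (plaquettePlus N p)) = vec h (plaquettePlus N p) ∧
          C (vec h (plaquetteMinus N p)) = -vec h (plaquetteMinus N p) ∧
          projPlus C (vec h (plaquettePlus N p)) = vec h (plaquettePlus N p) ∧
          projMinus C (vec h (plaquetteMinus N p)) = vec h (plaquetteMinus N p) ∧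
          vec h (plaquettePlus N p) ≠ 0 ∧
          (N ≠ 2 → vec h (plaquetteMinus N p) ≠ 0)) ∧
        (∀ p₁ p₂ : HalfPlaquette n,
          inner ℂ (vec h (plaquettePlus N p₁)) (vec h (plaquetteMinus N p₂)) = 0) := by
  refine ⟨exists_isThermodynamicLimit N n β, fun m hm => ?_⟩
  have h := isReflectionPositive_of_isThermodynamicLimit hβ.le hm
  obtain ⟨C, hC⟩ := exists_chargeConjugation h hm
  have hCC := hC.mul_self
  have hs := hC.isSelfAdjoint hm
  have hplus : ∀ p : HalfPlaquette n,
      C (vec h (plaquettePlus N p)) = vec h (plaquettePlus N p) := fun p => by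
    rw [hC, chargeConj_plaquettePlus]
  have hminus : ∀ p : HalfPlaquette n,
      C (vec h (plaquetteMinus N p)) = -vec h (plaquetteMinus N p) := fun p => by
    rw [hC, chargeConj_plaquetteMinus, vec_neg]
  have hplus0 : ∀ p : HalfPlaquette n, vec h (plaquettePlus N p) ≠ 0 := fun p =>
    vec_ne_zero h (osForm_plaquettePlus_pos (by omega) hβ hm p)
  have hminus0 : N ≠ 2 → ∀ p : HalfPlaquette n, vec h (plaquetteMinus N p) ≠ 0 := fun hN2 p =>
    vec_ne_zero h (osForm_plaquetteMinus_pos (by omega) hβ hm p)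
  -- Two spatial directions are needed for a plaquette in the hyperplane; this is where `2 ≤ n`
  -- enters.
  have hp : HalfPlaquette n :=
    ⟨0, ⟨1, by omega⟩, ⟨2, by omega⟩, rfl, by simp [Fin.lt_def], by simp [Fin.lt_def]⟩
  refine ⟨h, C, hC, fun C' hC' => hC.unique hC', ?_, hs, hCC,
    ⟨projPlus_mul_projPlus hCC, isSelfAdjoint_projPlus hs⟩,
    ⟨projMinus_mul_projMinus hCC, isSelfAdjoint_projMinus hs⟩,
    projPlus_mul_projMinus hCC, projMinus_mul_projPlus hCC,
    sectorPlus_isOrtho_sectorMinus hCC hs, isCompl_sectors hCC,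
    mem_sectorPlus hCC, mem_sectorMinus hCC, fun hN2 => ⟨?_, ?_⟩, fun hN2 => ?_,
    fun p => ⟨hplus p, hminus p, projPlus_eq_self (hplus p), projMinus_eq_self (hminus p),
      hplus0 p, fun hN2 => hminus0 hN2 p⟩,
    fun p₁ p₂ => inner_eq_zero_of_eigen hs (hplus p₁) (hminus p₂)⟩
  · rw [Unitary.mem_iff, hs.star_eq]
    exact ⟨hCC, hCC⟩
  · exact (Submodule.ne_bot_iff _).mpr
      ⟨_, (mem_sectorPlus hCC _).mpr (hplus hp), hplus0 hp⟩
  · exact (Submodule.ne_bot_iff _).mpr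
      ⟨_, (mem_sectorMinus hCC _).mpr (hminus hp), hminus0 hN2 hp⟩
  · subst hN2
    -- For `N = 2` the identity also satisfies the defining property of charge conjugation, so
    -- uniqueness applies.
    have h1 : C = 1 := hC.unique (C' := 1) (fun F => by rw [chargeConj_two]; rfl) |>.symm
    subst h1
    refine ⟨rfl, ?_, ?_⟩
    · rw [Submodule.eq_top_iff']
      exact fun v => (mem_sectorPlus hCC v).mpr rfl
    · rw [sectorMinus, projMinus, sub_self, smul_zero]
      exact LinearMap.range_zero
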